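/- Let $(R,\mathfrak m)$ be an F-finite regular local domain of prime characteristic $p$ and Krull dimension $d$, and let $0\ne f\in R$. For an ideal $I$ let $I^{[p^e]}$ be the ideal generated by the $p^e$-th powers of the elements of $I$. For real $t\ge 0$ and $e\ge 0$ put $$\lambda_e(t)=\ell_R\left(R/(\mathfrak m^{[p^e]}:f^{\lceil t(p^e-1)\rceil})\right).$$ The F-signature of the pair $(R,f^t)$ is $s(R,f^t)=\lim_{e\to\infty}p^{-ed}\lambda_e(t)$. The F-splitting dimension $\operatorname{sdim}(R,f^t)$ is the greatest integer $m$ for which $\limsup_{e\to\infty}p^{-em}\lambda_e(t)$ is nonzero, and the F-splitting ratio $r_F(R,f^t)$ is the value of this $\limsup$ for $m=\operatorname{sdim}(R,f^t)$. The pair $(R,f^t)$ is called (sharply) F-pure if for some $e>0$ the $R$-linear map $R\to F^e_*R$, $1\mapsto F^e_*f^{\lceil t(p^e-1)\rceil}$, splits, and the F-pure threshold $\mathrm{FPT}(f)\in[0,\infty]$ is the supremum of all $t\ge 0$ for which $(R,f^t)$ is F-pure. Suppose that $c=\mathrm{FPT}(f)$ is a (finite) rational number whose denominator is not divisible by $p$.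 Then $\operatorname{sdim}(R,f^c)$ exists (there is a greatest such $m$), $r_F(R,f^c)$ is finite, and $c$ can be written as $c=a/(p^s-1)$ with integers $a\ge 0$, $s\ge 1$. For every such $a$ and $s$, put $K_e=p^{(e-1)s}+p^{(e-2)s}+\cdots+1$, $t_e=aK_e/p^{es}$ and $n=d-\operatorname{sdim}(R,f^c)$. Then $t_e\to c$ as $e\to\infty$, the limit defining $s(R,f^{t_e})$ exists for every $e$, and $$\limsup_{e\to\infty}\frac{s(R,f^{t_e})}{(t_e-c)^n}=(-c)^{-n}\,r_F(R,f^c).$$ -/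

import Mathlib

open Filter Topology
open scoped ENNReal

namespace FPair

noncomputable section

/-- The `e`-th Frobenius power `I^{[p^e]}`: the ideal generated by the `p^e`-th powers of the
elements of `I`. -/
def frobeniusPower {R : Type*} [CommRing R] (p : ℕ) (I : Ideal R) (e : ℕ) : Ideal R :=
  Ideal.span ((fun r : R => r ^ p ^ e) '' (I : Set R))

/-- The ideal `(𝔪^{[p^e]} : f^N)` of the local ring `(R, 𝔪)`. -/
def pairIdeal {R : Type*} [CommRing R] [IsLocalRing R] (p : ℕ) (f : R) (e N : ℕ) : Ideal R :=
  Submodule.colon (frobeniusPower p (IsLocalRing.maximalIdeal R) e) {f ^ N}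

/-- The length `ℓ_R (R / (𝔪^{[p^e]} : f^N))`. -/
def pairLength {R : Type*} [CommRing R] [IsLocalRing R] (p : ℕ) (f : R) (e N : ℕ) : ℕ∞ :=
  Module.length R (R ⧸ pairIdeal p f e N)

/-- The lengths `ℓ_R (R / (𝔪^{[p^e]} : f^N))` are finite when `R` is Noetherian, so that nothing
is lost when they are read as natural numbers below. -/
theorem pairLength_ne_top {R : Type*} [CommRing R] [IsLocalRing R] [IsNoetherianRing R]
    (p : ℕ) (f : R) (e N : ℕ) : pairLength p f e N ≠ ⊤ := by
  unfold pairLength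
  have hle : frobeniusPower p (IsLocalRing.maximalIdeal R) e ≤ pairIdeal p f e N := by
    intro x hx
    rw [pairIdeal, Submodule.mem_colon_singleton, smul_eq_mul]
    exact Ideal.mul_mem_right _ _ hx
  have hrad : IsLocalRing.maximalIdeal R ≤ (pairIdeal p f e N).radical := by
    intro x hx
    exact ⟨p ^ e, hle (Ideal.subset_span ⟨x, hx, rfl⟩)⟩
  obtain ⟨k, hk⟩ := Ideal.exists_pow_le_of_le_radical_of_fg hrad
    (IsNoetherian.noetherian (IsLocalRing.maximalIdeal R))
  by_cases htop : pairIdeal p f e N = ⊤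
  · have : Subsingleton (R ⧸ pairIdeal p f e N) := Ideal.Quotient.subsingleton_iff.mpr htop
    rw [Module.length_eq_zero]
    exact ENat.zero_ne_top
  · have : Nontrivial (R ⧸ pairIdeal p f e N) := Ideal.Quotient.nontrivial_iff.mpr htop
    have hloc : IsLocalRing (R ⧸ pairIdeal p f e N) :=
      IsLocalRing.of_surjective' (Ideal.Quotient.mk _) Ideal.Quotient.mk_surjective
    have hart : IsArtinianRing (R ⧸ pairIdeal p f e N) := by
      rw [isArtinianRing_iff_isNilpotent_maximalIdeal]
      refine ⟨k, ?_⟩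
      have hmap : IsLocalRing.maximalIdeal (R ⧸ pairIdeal p f e N) ≤
          (IsLocalRing.maximalIdeal R).map (Ideal.Quotient.mk (pairIdeal p f e N)) := by
        intro y hy
        obtain ⟨x, rfl⟩ := Ideal.Quotient.mk_surjective y
        refine Ideal.mem_map_of_mem _ ?_
        rw [IsLocalRing.mem_maximalIdeal, mem_nonunits_iff] at hy ⊢
        exact fun h => hy (h.map _)
      rw [Ideal.zero_eq_bot, ← le_bot_iff]
      refine (Ideal.pow_right_mono hmap k).trans ?_
      rw [← Ideal.map_pow, Ideal.map_le_iff_le_comap]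
      intro x hx
      rw [Ideal.mem_comap, Ideal.mem_bot]
      exact Ideal.Quotient.eq_zero_iff_mem.mpr (hk hx)
    have h := Module.length_eq_of_surjective (S := R) (M := R ⧸ pairIdeal p f e N)
      (R := R ⧸ pairIdeal p f e N) Ideal.Quotient.mk_surjective
    exact h ▸ Module.length_ne_top

/-- The Krull dimension as a natural number (it is finite for a Noetherian local ring). -/
def dimNat (R : Type*) [CommRing R] : ℕ := ((ringKrullDim R).unbotD 0).toNat

/-- The sequence `p^{-ed} ℓ_R (R / (𝔪^{[p^e]} : f^{⌈t(p^e-1)⌉}))`, `d = dim R`, whose limit is the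
F-signature. -/
def fSignatureSeq {R : Type*} [CommRing R] [IsLocalRing R] (p : ℕ) (f : R) (t : ℝ) (e : ℕ) : ℝ :=
  ((pairLength p f e ⌈t * ((p : ℝ) ^ e - 1)⌉₊).toNat : ℝ) / (p : ℝ) ^ (e * dimNat R)

/-- The F-signature `s(R, f^t)`. -/
def fSignature {R : Type*} [CommRing R] [IsLocalRing R] (p : ℕ) (f : R) (t : ℝ) : ℝ :=
  limUnder atTop (fSignatureSeq p f t)

/-- `limsup_e p^{-em} ℓ_R (R / (𝔪^{[p^e]} : f^{⌈t(p^e-1)⌉}))`, an element of `[0, ∞]`. -/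
def splittingLimsup {R : Type*} [CommRing R] [IsLocalRing R] (p : ℕ) (f : R) (t : ℝ) (m : ℤ) :
    ℝ≥0∞ :=
  limsup (fun e : ℕ => (p : ℝ≥0∞) ^ (-((e : ℤ) * m)) *
    (pairLength p f e ⌈t * ((p : ℝ) ^ e - 1)⌉₊ : ℝ≥0∞)) atTop

/-- The F-splitting dimension `sdim(R, f^t)`: the greatest integer `m` for which
`limsup_e p^{-em} ℓ_R (R / (𝔪^{[p^e]} : f^{⌈t(p^e-1)⌉}))` is nonzero. -/
def splittingDim {R : Type*} [CommRing R] [IsLocalRing R] (p : ℕ) (f : R) (t : ℝ) : ℤ :=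
  sSup {m : ℤ | splittingLimsup p f t m ≠ 0}

/-- The F-splitting ratio `r_F(R, f^t)`. -/
def splittingRatio {R : Type*} [CommRing R] [IsLocalRing R] (p : ℕ) (f : R) (t : ℝ) : ℝ≥0∞ :=
  splittingLimsup p f t (splittingDim p f t)

/-- Sharp F-purity of the pair `(R, f^t)`: for some `e > 0` the `R`-linear map `R → F^e_* R`,
`1 ↦ f^{⌈t(p^e-1)⌉}`, splits. An `R`-linear map `F^e_* R → R` is an additive map `φ : R → R` with
`φ (r^{p^e} x) = r φ(x)`. -/
def IsSharplyFPure {R : Type*} [CommRing R] (p : ℕ) (f : R) (t : ℝ) : Prop :=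
  ∃ e : ℕ, 0 < e ∧ ∃ φ : R →+ R,
    (∀ r x : R, φ (r ^ p ^ e * x) = r * φ x) ∧ φ (f ^ ⌈t * ((p : ℝ) ^ e - 1)⌉₊) = 1

/-- The F-pure threshold: the supremum of all real `t ≥ 0` such that `(R, f^t)` is F-pure
(it is `+∞` when `f` is a unit of an F-pure ring). -/
def fpt {R : Type*} [CommRing R] (p : ℕ) (f : R) : EReal :=
  sSup {x : EReal | ∃ t : ℝ, 0 ≤ t ∧ IsSharplyFPure p f t ∧ x = (t : EReal)}

/-- `t_e = a K_e / p^{es}` with `K_e = p^{(e-1)s} + ⋯ + p^s + 1`. -/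
def approx (p a s e : ℕ) : ℝ :=
  (a : ℝ) * (∑ i ∈ Finset.range e, (p : ℝ) ^ (i * s)) / (p : ℝ) ^ (e * s)

end

end FPair

/-! Put `q = p^s` with `c = a/(q-1)`. Then `c(q^k-1) = aK_k` is an integer, so along multiples of
`s` the lengths that define the splitting ratio are the colengths `l_k` of the ideals `J_k =
(𝔪^{[q^k]} : f^{aK_k})` (`splitIdeal`). The number `t_k = aK_k/q^k` has a power of `p` as
denominator, and flatness of the Frobenius makes its signature sequence eventually constant, with
value `s(R,f^{t_k}) = l_k/q^{kd}` (`tendsto_fSignatureSeq`). As `t_k - c = -c/q^k`, the quotient in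
the theorem equals `(-c)^{-n} l_k/q^{km}` with `m = d-n`. Everything thus rests on `l_k/q^{km}`
having a positive finite limit for some `m` (`exists_tendsto_length_splitIdeal`).

For that limit: the pair is F-pure at its threshold, i.e. `f^a ∉ 𝔪^{[q]}` (`pow_notMem_of_fpt`).
Hence the `J_k` decrease, and their intersection `P` is prime. A splitting with `f^a ↦ 1`,
precomposed with multiplication by `f^a`, maps `J_{k+1}` into `J_k` and descends to a Frobenius
splitting of `D = R/P`. Comparing `F^s_*D` with a free module of the same rank, in both directions,
yields `α l_{k+1} = ρ l_k` up to a multiple of `ℓ(R/(J_k+g))` for a fixed `g ∉ P`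
(`exists_length_estimate`). Since `(J_{k+j} : g^i) ⊆ J_k` for `i ≤ q^k` (`colon_splitIdeal_le`),
this error is `O(l_k/q^k)`. The relative errors are summable, so `l_k` is asymptotic to a positive
multiple of `(ρ/α)^k` (`exists_tendsto_div_pow`). The rank `ρ` and the residue degree `α` are powers
of `p`, which makes the exponent `m` an integer.

Finally, if `s₀` is the order of `p` modulo the denominator of `c`, the lengths vanish at every `e`
not divisible by `s₀` (`dvd_of_pairLength_ne_zero`), so the limsup is the limit along multiples of
`s₀`; every admissible `s` is such a multiple. The input from regularity is that `F^e_*R` is free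
(`free_frobAlg`). -/

namespace FPair

open IsLocalRing RingTheory.Sequence

universe u v

/-! ### Regular local rings: regular sequences and a freeness criterion -/

section RegularSequence

/-- Dividing a regular local ring by a minimal generator of the maximal ideal gives a regular local
ring of dimension one less. -/
theorem isRegularLocalRing_quotient {R : Type u} [CommRing R] [IsRegularLocalRing R] {n : ℕ}
    (hn : ringKrullDim R = (n + 1 : ℕ)) {x : R} (hx : x ∈ maximalIdeal R)
    (hx2 : x ∉ maximalIdeal R ^ 2) :
    IsRegularLocalRing (R ⧸ Ideal.span {x}) ∧ ringKrullDim (R ⧸ Ideal.span {x}) = n := by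
  classical
  have hne : Ideal.span {x} ≠ ⊤ := fun h => by
    have := (Ideal.span_singleton_le_iff_mem (maximalIdeal R)).2 hx
    exact (maximalIdeal.isMaximal R).ne_top (top_le_iff.1 (h ▸ this))
  have : Nontrivial (R ⧸ Ideal.span {x}) := Ideal.Quotient.nontrivial_iff.mpr hne
  have hloc : IsLocalRing (R ⧸ Ideal.span {x}) :=
    IsLocalRing.of_surjective' (Ideal.Quotient.mk _) Ideal.Quotient.mk_surjective
  obtain ⟨S, hS, hspan⟩ := Submodule.FG.exists_span_finset_card_eq_spanFinrank
    (IsNoetherian.noetherian (maximalIdeal R))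
  have hcard : S.card = n + 1 := by
    have := IsRegularLocalRing.spanFinrank_maximalIdeal (R := R)
    rw [hn, ← hS] at this
    exact_mod_cast this
  obtain ⟨c, -, hc⟩ := Submodule.mem_span_finset.1 (hspan ▸ hx : x ∈ Submodule.span R (S : Set R))
  obtain ⟨j, hjS, hj⟩ : ∃ j ∈ S, IsUnit (c j) := by
    by_contra! h
    refine hx2 (hc ▸ Ideal.sum_mem _ fun s hs => ?_)
    rw [pow_two]
    exact Ideal.mul_mem_mul ((mem_maximalIdeal _).2 (h s hs))
      (hspan ▸ Submodule.subset_span hs : s ∈ maximalIdeal R)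
  set π := Ideal.Quotient.mk (Ideal.span {x})
  have hmap : maximalIdeal (R ⧸ Ideal.span {x}) = Ideal.span (((S.erase j).image π : Finset _) : Set _) := by
    rw [← map_maximalIdeal_of_surjective π Ideal.Quotient.mk_surjective]
    apply le_antisymm
    · rw [← hspan, Ideal.map_le_iff_le_comap]
      refine Submodule.span_le.2 fun s hs => ?_
      by_cases hsj : s = j
      · subst hsj
        obtain ⟨u, hu⟩ := hj
        have h1 : c s * s = x - ∑ a ∈ S.erase s, c a * a := by
          rw [← hc, ← Finset.add_sum_erase S _ hjS]
          simp
        have h2 : s = ↑u⁻¹ * (x - ∑ a ∈ S.erase s, c a * a) := by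
          rw [← h1, ← hu, Units.inv_mul_cancel_left]
        change π s ∈ (Ideal.span (((S.erase s).image π : Finset _) : Set _) : Ideal (R ⧸ Ideal.span {x}))
        rw [congrArg π h2, map_mul, map_sub, (Ideal.Quotient.eq_zero_iff_mem.2
          (Ideal.mem_span_singleton_self x) : π x = 0), map_sum]
        refine Ideal.mul_mem_left _ _ (Ideal.sub_mem _ (Ideal.zero_mem _)
          (Ideal.sum_mem _ fun a ha => ?_))
        rw [map_mul]
        exact Ideal.mul_mem_left _ _ (Ideal.subset_span (by
          exact_mod_cast Finset.mem_image_of_mem π ha))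
      · exact Ideal.subset_span (by
          exact_mod_cast Finset.mem_image_of_mem π (Finset.mem_erase.2 ⟨hsj, hs⟩))
    · refine Ideal.span_le.2 fun y hy => ?_
      obtain ⟨s, hs, rfl⟩ := Finset.mem_image.1 (Finset.mem_coe.1 hy)
      exact Ideal.mem_map_of_mem _ (hspan ▸ Submodule.subset_span (Finset.mem_of_mem_erase hs))
  have hle : (maximalIdeal (R ⧸ Ideal.span {x})).spanFinrank ≤ n := by
    rw [hmap]
    refine (Submodule.spanFinrank_span_le_ncard_of_finite (Finset.finite_toSet _)).trans ?_
    rw [Set.ncard_coe_finset]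
    refine Finset.card_image_le.trans ?_
    rw [Finset.card_erase_of_mem hjS, hcard]
    rfl
  have hdim : (n : WithBot ℕ∞) ≤ ringKrullDim (R ⧸ Ideal.span {x}) := by
    have := ringKrullDim_le_ringKrullDim_quotSMulTop_succ hx
    rw [← Submodule.ideal_span_singleton_smul, smul_eq_mul, Ideal.mul_top, hn, Nat.cast_add] at this
    exact ENat.WithBot.add_le_add_one_right_iff.1 this
  have hreg : IsRegularLocalRing (R ⧸ Ideal.span {x}) :=
    IsRegularLocalRing.of_spanFinrank_maximalIdeal_le _
      (le_trans (by exact_mod_cast hle) hdim)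
  refine ⟨hreg, le_antisymm ?_ hdim⟩
  rw [← IsRegularLocalRing.spanFinrank_maximalIdeal (R := R ⧸ Ideal.span {x})]
  exact_mod_cast hle

/-- Prime avoidance, with `𝔪 ^ 2` as the one ideal that need not be prime; Nakayama excludes `𝔪 ≤ 𝔪
^ 2`, and positive dimension excludes that `𝔪` is a minimal prime. -/
theorem exists_minimal_generator {R : Type u} [CommRing R] [IsLocalRing R] [IsNoetherianRing R]
    (h0 : ringKrullDim R ≠ 0) :
    ∃ x ∈ maximalIdeal R, x ∉ maximalIdeal R ^ 2 ∧ ∀ Q ∈ minimalPrimes R, x ∉ Q := by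
  classical
  have hmin : maximalIdeal R ∉ minimalPrimes R := fun h => h0 <| by
    rw [← maximalIdeal_height_eq_ringKrullDim, Ideal.height_eq_zero_iff.2 h]
    rfl
  by_contra! H
  set T := (minimalPrimes.finite_of_isNoetherianRing R).toFinset
  -- The avoidance lemma allows two arbitrary ideals besides the primes; both slots are filled with
  -- `𝔪 ^ 2`, indexed by `none`.
  have hsub : (maximalIdeal R : Set R) ⊆
      ((maximalIdeal R ^ 2 : Ideal R) : Set R) ∪ ((maximalIdeal R ^ 2 : Ideal R) : Set R) ∪
        ⋃ i ∈ (T.image some : Finset (Option (Ideal R))),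
          ((i.elim (maximalIdeal R ^ 2) id : Ideal R) : Set R) := by
    intro x hx
    by_cases hx2 : x ∈ maximalIdeal R ^ 2
    · exact Or.inl (Or.inl hx2)
    · obtain ⟨Q, hQ, hxQ⟩ := H x hx hx2
      refine Or.inr (Set.mem_iUnion₂.2 ⟨some Q, ?_, hxQ⟩)
      exact Finset.mem_image_of_mem _ (by simpa [T] using hQ)
  have key := (Ideal.subset_union_prime' (s := T.image some)
    (f := fun i : Option (Ideal R) => (i.elim (maximalIdeal R ^ 2) id : Ideal R))
    (a := none) (b := none) (fun i hi => by
      obtain ⟨Q, hQ, rfl⟩ := Finset.mem_image.1 hi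
      exact (minimalPrimes.finite_of_isNoetherianRing R |>.mem_toFinset.1 hQ).1.1)).1 hsub
  have h1 : ¬ maximalIdeal R ≤ maximalIdeal R ^ 2 := fun h => by
    have hbot : maximalIdeal R = ⊥ := Submodule.eq_bot_of_le_smul_of_le_jacobson_bot
      (maximalIdeal R) _ (IsNoetherian.noetherian _) (by rwa [smul_eq_mul, ← pow_two])
      (maximalIdeal_le_jacobson _)
    exact h0 (ringKrullDim_eq_zero_of_isField (isField_iff_maximalIdeal_eq.2 hbot))
  rcases key with h | h | ⟨i, hi, h⟩
  · exact h1 h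
  · exact h1 h
  · obtain ⟨Q, hQ, rfl⟩ := Finset.mem_image.1 hi
    have hQ' := (minimalPrimes.finite_of_isNoetherianRing R).mem_toFinset.1 hQ
    have : Q = maximalIdeal R := le_antisymm (le_maximalIdeal hQ'.1.1.ne_top) h
    exact hmin (this ▸ hQ')

/-- Both claims go through one induction on the dimension. The quotient by a minimal generator `x`
is a domain, so `(x)` is prime and contains a minimal prime `Q`. As `x ∉ Q`, one gets `Q = xQ ⊆ 𝔪Q`,
hence `Q = 0` by Nakayama. Thus `R` is a domain, `x` is regular, and a sequence of the quotient
lifts. -/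
theorem isDomain_and_exists_regular_sequence (n : ℕ) :
    ∀ (R : Type u) [CommRing R] [IsRegularLocalRing R], ringKrullDim R = n →
      IsDomain R ∧ ∃ rs : List R, Ideal.ofList rs = maximalIdeal R ∧ IsWeaklyRegular R rs ∧
        rs.length = n := by
  induction n with
  | zero =>
    intro R _ _ hR
    have hm : maximalIdeal R = ⊥ := by
      have := IsRegularLocalRing.spanFinrank_maximalIdeal (R := R)
      rw [hR] at this
      exact (Submodule.spanFinrank_eq_zero_iff_eq_bot (IsNoetherian.noetherian _)).1
        (by exact_mod_cast this)
    exact ⟨(isField_iff_maximalIdeal_eq.2 hm).isDomain, [], by rw [hm, Ideal.ofList_nil],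
      .nil R R, rfl⟩
  | succ n ih =>
    intro R _ _ hR
    obtain ⟨x, hx, hx2, hmin⟩ := exists_minimal_generator (R := R)
      (by rw [hR]; exact_mod_cast n.succ_ne_zero)
    obtain ⟨hreg, hdim⟩ := isRegularLocalRing_quotient hR hx hx2
    obtain ⟨hdom, rs, hrs, hwr, hlen⟩ := ih _ hdim
    have hprime : (Ideal.span {x}).IsPrime := (Ideal.Quotient.isDomain_iff_prime _).1 hdom
    obtain ⟨Q, hQ, hQle⟩ := Ideal.exists_minimalPrimes_le (bot_le : (⊥ : Ideal R) ≤ Ideal.span {x})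
    have hQ' : Q ∈ minimalPrimes R := hQ
    have hQp : Q.IsPrime := hQ'.1.1
    have hQ0 : Q = ⊥ := by
      refine Submodule.eq_bot_of_le_smul_of_le_jacobson_bot (maximalIdeal R) _
        (IsNoetherian.noetherian _) (fun y hy => ?_) (maximalIdeal_le_jacobson _)
      obtain ⟨z, rfl⟩ := Ideal.mem_span_singleton'.1 (hQle hy)
      rw [mul_comm]
      exact Ideal.mul_mem_mul hx ((hQp.mem_or_mem hy).resolve_right (hmin Q hQ'))
    have hdomR : IsDomain R := by
      rw [hQ0] at hQp
      exact IsDomain.of_bot_isPrime R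
    have hx0 : x ≠ 0 := fun h => hx2 (h ▸ Ideal.zero_mem _)
    have hsurj : Function.Surjective (algebraMap R (R ⧸ Ideal.span {x})) :=
      Ideal.Quotient.mk_surjective
    obtain ⟨t, rfl⟩ := List.map_surjective_iff.2 hsurj rs
    refine ⟨hdomR, x :: t, ?_, ?_, by simpa using hlen⟩
    · rw [Ideal.ofList_cons]
      have h1 : (maximalIdeal (R ⧸ Ideal.span {x})).comap (Ideal.Quotient.mk (Ideal.span {x})) =
          maximalIdeal R := by
        have := Ideal.comap_isMaximal_of_surjective (Ideal.Quotient.mk (Ideal.span {x}))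
          Ideal.Quotient.mk_surjective (K := maximalIdeal (R ⧸ Ideal.span {x}))
        exact eq_maximalIdeal this
      rw [← h1, ← hrs, ← Ideal.map_ofList]
      change _ = ((Ideal.ofList t).map (Ideal.Quotient.mk _)).comap _
      rw [Ideal.comap_map_of_surjective _ Ideal.Quotient.mk_surjective, ← RingHom.ker_eq_comap_bot,
        Ideal.mk_ker, sup_comm]
    · refine .cons (fun a b h => mul_left_cancel₀ hx0 (by simpa using h)) ?_
      rw [isWeaklyRegular_map_algebraMap_iff] at hwr
      refine ((Submodule.quotEquivOfEq _ _ ?_).isWeaklyRegular_congr t).2 hwr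
      rw [← Submodule.ideal_span_singleton_smul, smul_eq_mul, Ideal.mul_top]

/-- A finite module over a Noetherian local ring, on which a list of generators of the maximal ideal
is weakly regular, is free. -/
theorem free_of_isWeaklyRegular (n : ℕ) :
    ∀ (R : Type u) [CommRing R] [IsLocalRing R] [IsNoetherianRing R] (M : Type u) [AddCommGroup M]
      [Module R M] [Module.Finite R M] (rs : List R), rs.length = n →
      Ideal.ofList rs = maximalIdeal R → IsWeaklyRegular M rs → Module.Free R M := by
  induction n with
  | zero =>
    intro R _ _ _ M _ _ _ rs hl hrs hM
    obtain rfl := List.length_eq_zero_iff.1 hl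
    rw [Ideal.ofList_nil] at hrs
    let := (isField_iff_maximalIdeal_eq.2 hrs.symm).toField
    exact Module.Free.of_divisionRing R M
  | succ n ih =>
    intro R _ _ _ M _ _ _ rs hl hrs hM
    obtain ⟨x, t, rfl⟩ : ∃ x t, rs = x :: t := List.exists_cons_of_length_eq_add_one hl
    rw [isWeaklyRegular_cons_iff'] at hM
    have hx : x ∈ maximalIdeal R := hrs ▸ Ideal.subset_span (by simp)
    have hne : Ideal.span {x} ≠ ⊤ := fun h => by
      have := (Ideal.span_singleton_le_iff_mem (maximalIdeal R)).2 hx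
      exact (maximalIdeal.isMaximal R).ne_top (top_le_iff.1 (h ▸ this))
    have : Nontrivial (R ⧸ Ideal.span {x}) := Ideal.Quotient.nontrivial_iff.mpr hne
    have hloc : IsLocalRing (R ⧸ Ideal.span {x}) :=
      IsLocalRing.of_surjective' (Ideal.Quotient.mk _) Ideal.Quotient.mk_surjective
    have hfin := Module.Finite.of_restrictScalars_finite R (R ⧸ Ideal.span {x}) (QuotSMulTop x M)
    have := Module.finitePresentation_of_finite R M
    rw [← Module.free_quotSMulTop_iff_free R M (maximalIdeal_le_jacobson _ hx) hM.1]
    refine ih _ _ _ (by simpa using hl) ?_ hM.2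
    rw [← map_maximalIdeal_of_surjective (Ideal.Quotient.mk (Ideal.span {x}))
      Ideal.Quotient.mk_surjective, ← hrs, Ideal.map_ofList, List.map_cons, Ideal.ofList_cons,
      Ideal.Quotient.eq_zero_iff_mem.2 (Ideal.mem_span_singleton_self x)]
    simp

end RegularSequence

/-! ### Colengths of powers of a regular sequence -/

section Powers

variable {R : Type u} [CommRing R]

/-- `ℓ(R/(I + g^{n+1})) = ℓ(R/((I + g^{n+1}) : g^n)) + ℓ(R/(I + g^n))`. -/
theorem length_quotient_sup_span_pow_succ (I : Ideal R) (g : R) (n : ℕ) :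
    Module.length R (R ⧸ (I ⊔ Ideal.span {g ^ (n + 1)})) =
      Module.length R (R ⧸ Submodule.colon (I ⊔ Ideal.span {g ^ (n + 1)}) {g ^ n}) +
      Module.length R (R ⧸ (I ⊔ Ideal.span {g ^ n})) := by
  set A := I ⊔ Ideal.span {g ^ (n + 1)}
  have hle : A ≤ I ⊔ Ideal.span {g ^ n} := sup_le_sup le_rfl
    (Ideal.span_singleton_le_span_singleton.2 ⟨g, pow_succ g n⟩)
  have hcomap : Submodule.colon A {g ^ n} = Submodule.comap (LinearMap.mulRight R (g ^ n)) A := by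
    ext y
    rw [Submodule.mem_colon_singleton, Submodule.mem_comap]
    rfl
  refine Module.length_eq_add_of_exact
    (Submodule.mapQ (Submodule.colon A {g ^ n}) A (LinearMap.mulRight R (g ^ n)) hcomap.le)
    (Submodule.factor hle) ?_ (Submodule.factor_surjective hle) ?_
  · rw [← LinearMap.ker_eq_bot, Submodule.ker_mapQ, ← hcomap, Submodule.mkQ_map_self]
  · intro y
    obtain ⟨y, rfl⟩ := Submodule.mkQ_surjective _ y
    constructor
    · intro hy
      have hy' : y ∈ I ⊔ Ideal.span {g ^ n} :=
        (Submodule.Quotient.mk_eq_zero _).1 hy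
      obtain ⟨a, ha, b, hb, rfl⟩ := Submodule.mem_sup.1 hy'
      obtain ⟨r, rfl⟩ := Ideal.mem_span_singleton'.1 hb
      refine ⟨Submodule.Quotient.mk r, ?_⟩
      rw [Submodule.mapQ_apply, Submodule.mkQ_apply, Submodule.Quotient.eq]
      have : r * g ^ n - (a + r * g ^ n) = -a := by ring
      rw [LinearMap.mulRight_apply, this]
      exact neg_mem (Ideal.mem_sup_left ha)
    · rintro ⟨r, hr⟩
      obtain ⟨r, rfl⟩ := Submodule.mkQ_surjective _ r
      rw [← hr]
      rw [Submodule.mkQ_apply, Submodule.mapQ_apply]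
      have : r * g ^ n ∈ I ⊔ Ideal.span {g ^ n} :=
        Ideal.mem_sup_right (Ideal.mul_mem_left _ _ (Ideal.mem_span_singleton_self _))
      exact (Submodule.Quotient.mk_eq_zero _).2 this

/-- Regularity of `x` modulo `I` identifies each colon `(I + x^{n+1}) : x^n` with `I + (x)`, so
every further power contributes the same length. -/
theorem length_quotient_sup_span_pow {I : Ideal R} {x : R} (hx : IsSMulRegular (R ⧸ I) x) (n : ℕ) :
    Module.length R (R ⧸ (I ⊔ Ideal.span {x ^ n})) =
      n * Module.length R (R ⧸ (I ⊔ Ideal.span {x})) := by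
  induction n with
  | zero =>
    have : (I ⊔ Ideal.span {x ^ 0}) = ⊤ := by simp
    rw [this]
    simp
  | succ n ih =>
    have hcol : Submodule.colon (I ⊔ Ideal.span {x ^ (n + 1)}) {x ^ n} = I ⊔ Ideal.span {x} := by
      apply le_antisymm
      · intro y hy
        rw [Submodule.mem_colon_singleton, smul_eq_mul] at hy
        obtain ⟨a, ha, b, hb, hab⟩ := Submodule.mem_sup.1 hy
        obtain ⟨r, rfl⟩ := Ideal.mem_span_singleton'.1 hb
        have h1 : x ^ n * (y - r * x) ∈ I := by
          have : x ^ n * (y - r * x) = a := by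
            rw [eq_sub_of_add_eq hab]
            ring
          rwa [this]
        have h2 : y - r * x ∈ I := mem_of_isSMulRegular_quotient_of_smul_mem (hx.pow n) h1
        have : y = (y - r * x) + r * x := by ring
        rw [this]
        exact Submodule.add_mem_sup h2 (Ideal.mul_mem_left _ _ (Ideal.mem_span_singleton_self _))
      · refine sup_le (fun y hy => ?_) ((Ideal.span_singleton_le_iff_mem _).2 ?_)
        · exact Submodule.mem_colon_singleton.2 (Ideal.mem_sup_left (I.mul_mem_right _ hy))
        · rw [Submodule.mem_colon_singleton, smul_eq_mul, ← pow_succ']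
          exact Ideal.mem_sup_right (Ideal.mem_span_singleton_self _)
    rw [length_quotient_sup_span_pow_succ, ih, hcol]
    push_cast
    ring

theorem isWeaklyRegular_concat_iff (l : List R) (x : R) :
    IsWeaklyRegular R (l ++ [x]) ↔ IsWeaklyRegular R l ∧ IsSMulRegular (R ⧸ Ideal.ofList l) x := by
  rw [isWeaklyRegular_append_iff, isWeaklyRegular_singleton_iff]
  have h : (Ideal.ofList l • ⊤ : Submodule R R) = Ideal.ofList l := by simp
  rw [h]

theorem ofList_perm {l l' : List R} (h : l.Perm l') : Ideal.ofList l = Ideal.ofList l' :=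
  congrArg Ideal.span (Set.ext fun _ => h.mem_iff)

/-- Replacing the elements of a regular sequence by their `n`-th powers. -/
theorem isWeaklyRegular_pow_append [IsLocalRing R] [IsNoetherianRing R] {n : ℕ} (hn : 0 < n)
    (l₁ : List R) :
    ∀ l₂ : List R, (∀ x ∈ l₁ ++ l₂, x ∈ maximalIdeal R) → IsWeaklyRegular R (l₁ ++ l₂) →
      IsWeaklyRegular R (l₁.map (· ^ n) ++ l₂) ∧
      Module.length R (R ⧸ Ideal.ofList (l₁.map (· ^ n) ++ l₂)) =
        (n ^ l₁.length : ℕ) * Module.length R (R ⧸ Ideal.ofList (l₁ ++ l₂)) := by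
  induction l₁ with
  | nil => intro l₂ _ h; exact ⟨h, by rw [List.map_nil, List.length_nil, pow_zero, Nat.cast_one, one_mul]⟩
  | cons x t ih =>
    intro l₂ hmem hreg
    -- Regular sequences in a local ring may be permuted: `x` is moved to the end, where raising it
    -- to a power affects only the last quotient, and then moved back.
    have hp : (x :: t ++ l₂).Perm (t ++ (l₂ ++ [x])) := by
      rw [← List.append_assoc]
      exact (List.perm_append_singleton x (t ++ l₂)).symm
    have hmem' : ∀ y ∈ t ++ (l₂ ++ [x]), y ∈ maximalIdeal R := fun y hy => hmem y (hp.mem_iff.2 hy)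
    obtain ⟨h1, h2⟩ := ih (l₂ ++ [x]) hmem'
      (isWeaklyRegular_of_perm_of_subset_maximalIdeal hreg hp hmem)
    rw [← List.append_assoc] at h1 h2
    obtain ⟨h3, h4⟩ := (isWeaklyRegular_concat_iff _ _).1 h1
    have h5 : IsWeaklyRegular R ((t.map (· ^ n) ++ l₂) ++ [x ^ n]) :=
      (isWeaklyRegular_concat_iff _ _).2 ⟨h3, h4.pow n⟩
    have hp' : ((t.map (· ^ n) ++ l₂) ++ [x ^ n]).Perm ((x :: t).map (· ^ n) ++ l₂) :=
      List.perm_append_singleton _ _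
    refine ⟨isWeaklyRegular_of_perm_of_subset_maximalIdeal h5 hp' fun y hy => ?_, ?_⟩
    · rcases List.mem_append.1 hy with hy | hy
      · rcases List.mem_append.1 hy with hy | hy
        · obtain ⟨z, hz, rfl⟩ := List.mem_map.1 hy
          exact Ideal.pow_mem_of_mem _ (hmem z (by simp [hz])) n hn
        · exact hmem y (by simp [hy])
      · obtain rfl := List.mem_singleton.1 hy
        exact Ideal.pow_mem_of_mem _ (hmem x (by simp)) n hn
    · rw [← ofList_perm hp', Ideal.ofList_append, Ideal.ofList_singleton,
        length_quotient_sup_span_pow h4, ← Ideal.ofList_singleton, ← Ideal.ofList_append, h2,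
        ofList_perm hp, List.length_cons, pow_succ]
      push_cast
      ring

theorem isWeaklyRegular_pow [IsLocalRing R] [IsNoetherianRing R] {n : ℕ} (hn : 0 < n)
    {l : List R} (hl : Ideal.ofList l = maximalIdeal R) (hreg : IsWeaklyRegular R l) :
    IsWeaklyRegular R (l.map (· ^ n)) ∧
      Module.length R (R ⧸ Ideal.ofList (l.map (· ^ n))) = (n ^ l.length : ℕ) := by
  have hmem : ∀ x ∈ l ++ [], x ∈ maximalIdeal R := fun x hx =>
    hl ▸ Ideal.subset_span (by simpa using hx)
  have := isWeaklyRegular_pow_append hn l [] hmem (by simpa using hreg)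
  rw [List.append_nil, List.append_nil] at this
  refine ⟨this.1, this.2.trans ?_⟩
  have hs : IsSimpleModule R (R ⧸ Ideal.ofList l) := by
    rw [hl, isSimpleModule_iff_isCoatom]
    exact (maximalIdeal.isMaximal R).out
  rw [Module.length_eq_one, mul_one]

end Powers

/-! ### Frobenius pushforwards and Frobenius powers of ideals -/

/-- The ring `F^e_* A`: the ring `A`, viewed as an `A`-algebra through the `e`-th iterate of the
Frobenius. -/
@[nolint unusedArguments]
def FrobAlg (_p _e : ℕ) (A : Type u) : Type u := A

namespace FrobAlg

instance (p e : ℕ) (A : Type u) [CommRing A] : CommRing (FrobAlg p e A) :=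
  inferInstanceAs (CommRing A)

instance (p e : ℕ) (A : Type u) [CommRing A] [IsDomain A] : IsDomain (FrobAlg p e A) :=
  inferInstanceAs (IsDomain A)

instance (p e : ℕ) (A : Type u) [CommRing A] [IsLocalRing A] : IsLocalRing (FrobAlg p e A) :=
  inferInstanceAs (IsLocalRing A)

instance (p e : ℕ) (A : Type u) [Field A] : Field (FrobAlg p e A) :=
  inferInstanceAs (Field A)

/-- The identity, as a ring isomorphism `A ≃ F^e_* A`. -/
def of (p e : ℕ) (A : Type u) [CommRing A] : A ≃+* FrobAlg p e A := RingEquiv.refl A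

variable {p : ℕ} {e : ℕ} {A : Type u} [CommRing A] [ExpChar A p]

instance : Algebra A (FrobAlg p e A) := (iterateFrobenius A p e).toAlgebra

theorem smul_of (a x : A) : a • of p e A x = of p e A (a ^ p ^ e * x) := rfl

theorem finite (h : (frobenius A p).Finite) (e : ℕ) : Module.Finite A (FrobAlg p e A) := by
  suffices (iterateFrobenius A p e).Finite from this
  induction e with
  | zero =>
    have : iterateFrobenius A p 0 = RingHom.id A := by ext; simp
    rw [this]
    exact RingHom.Finite.id A
  | succ e ih =>
    have : iterateFrobenius A p (e + 1) = (frobenius A p).comp (iterateFrobenius A p e) := by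
      ext; simp [iterateFrobenius_def, frobenius_def, pow_succ, pow_mul]
    rw [this]
    exact h.comp ih

theorem finite_frobenius_quotient (h : (frobenius A p).Finite) (I : Ideal A)
    [ExpChar (A ⧸ I) p] : (frobenius (A ⧸ I) p).Finite := by
  have h1 : ((frobenius (A ⧸ I) p).comp (Ideal.Quotient.mk I)).Finite := by
    have : (frobenius (A ⧸ I) p).comp (Ideal.Quotient.mk I) =
        (Ideal.Quotient.mk I).comp (frobenius A p) := by
      ext; simp [frobenius_def]
    rw [this]
    exact (RingHom.Finite.of_surjective _ Ideal.Quotient.mk_surjective).comp h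
  exact RingHom.Finite.of_comp_finite h1

end FrobAlg

theorem mem_frobeniusPower {p e : ℕ} {A : Type u} [CommRing A] [ExpChar A p] {I : Ideal A} {x : A} :
    x ∈ frobeniusPower p I e ↔ FrobAlg.of p e A x ∈ I.map (algebraMap A (FrobAlg p e A)) := Iff.rfl

theorem frobeniusPower_eq_map {p : ℕ} {A : Type u} [CommRing A] [ExpChar A p] (I : Ideal A)
    (e : ℕ) : frobeniusPower p I e = I.map (iterateFrobenius A p e) := rfl

theorem frobeniusPower_add {p : ℕ} {A : Type u} [CommRing A] [ExpChar A p] (I : Ideal A)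
    (e e' : ℕ) : frobeniusPower p (frobeniusPower p I e) e' = frobeniusPower p I (e + e') := by
  simp only [frobeniusPower_eq_map, Ideal.map_map]
  congr 1
  ext
  simp [iterateFrobenius_def, pow_add, pow_mul]

theorem frobeniusPower_mono {p : ℕ} {A : Type u} [CommRing A] {I J : Ideal A} (h : I ≤ J)
    (e : ℕ) : frobeniusPower p I e ≤ frobeniusPower p J e :=
  Ideal.span_mono (Set.image_mono h)

theorem pow_mem_frobeniusPower {p : ℕ} {A : Type u} [CommRing A] {I : Ideal A} {x : A} (h : x ∈ I)
    (e : ℕ) : x ^ p ^ e ∈ frobeniusPower p I e :=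
  Ideal.subset_span ⟨x, h, rfl⟩

theorem frobeniusPower_zero {p : ℕ} {A : Type u} [CommRing A] (I : Ideal A) :
    frobeniusPower p I 0 = I := by
  simp [frobeniusPower]

theorem linearMap_mem_of_mem_map {A : Type u} [CommRing A] {B : Type*} [CommRing B] [Algebra A B]
    (φ : B →ₗ[A] A) {I : Ideal A} {x : B} (hx : x ∈ I.map (algebraMap A B)) : φ x ∈ I := by
  replace hx : x ∈ I • (⊤ : Submodule A B) := by
    rw [Ideal.smul_top_eq_map]
    exact hx
  induction hx using Submodule.smul_induction_on' with
  | smul r hr n hn =>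
    rw [map_smul, smul_eq_mul]
    exact I.mul_mem_right _ hr
  | add x _ y _ hx hy =>
    rw [map_add]
    exact I.add_mem hx hy

/-- With a basis of `F^e_*R` this tests membership in `I^{[p^e]}` coordinatewise; it is how freeness
of the Frobenius enters the later arguments. -/
theorem mem_map_iff_repr {A : Type u} [CommRing A] {B : Type*} [CommRing B] [Algebra A B]
    {ι : Type*} [Fintype ι] (b : Module.Basis ι A B) {I : Ideal A} {x : B} :
    x ∈ I.map (algebraMap A B) ↔ ∀ i, b.repr x i ∈ I := by
  refine ⟨fun h i => linearMap_mem_of_mem_map (b.coord i) h, fun h => ?_⟩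
  rw [← b.sum_repr x]
  refine Ideal.sum_mem _ fun i _ => ?_
  rw [Algebra.smul_def]
  exact Ideal.mul_mem_right _ _ (Ideal.mem_map_of_mem _ (h i))

/-! ### Freeness of the Frobenius over a regular local ring -/

section Regular

variable {R : Type u} [CommRing R] [IsRegularLocalRing R] {p : ℕ} [ExpChar R p]

theorem dimNat_spec : ringKrullDim R = (dimNat R : ℕ) := by
  have h := IsRegularLocalRing.spanFinrank_maximalIdeal (R := R)
  have h' : dimNat R = (maximalIdeal R).spanFinrank := by
    rw [dimNat, ← h]
    rfl
  rw [h', h]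

theorem exists_regular_sequence (R : Type u) [CommRing R] [IsRegularLocalRing R] :
    ∃ rs : List R, Ideal.ofList rs = maximalIdeal R ∧
    IsWeaklyRegular R rs ∧ rs.length = dimNat R :=
  (isDomain_and_exists_regular_sequence _ R dimNat_spec).2

theorem pow_pos_of_expChar {p : ℕ} {A : Type u} [CommRing A] [ExpChar A p] (e : ℕ) : 0 < p ^ e :=
  pow_pos (expChar_pos A p) e

/-- The Frobenius of an F-finite regular local ring is free. -/
theorem free_frobAlg (h : (frobenius R p).Finite) (e : ℕ) : Module.Free R (FrobAlg p e R) := by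
  obtain ⟨rs, hrs, hreg, -⟩ := exists_regular_sequence R
  have := FrobAlg.finite h e
  refine free_of_isWeaklyRegular _ R (FrobAlg p e R) rs rfl hrs ?_
  -- On `F^e_*R` the elements of `rs` act as their `p^e`-th powers on `R`, and these powers again
  -- form a regular sequence.
  rw [← isWeaklyRegular_map_algebraMap_iff (FrobAlg p e R)]
  exact (isWeaklyRegular_pow (pow_pos_of_expChar (A := R) e) hrs hreg).1

theorem length_quotient_frobeniusPower_maximalIdeal (e : ℕ) :
    Module.length R (R ⧸ frobeniusPower p (maximalIdeal R) e) = (p ^ (e * dimNat R) : ℕ) := by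
  obtain ⟨rs, hrs, hreg, hl⟩ := exists_regular_sequence R
  have h := (isWeaklyRegular_pow (pow_pos_of_expChar (A := R) (p := p) e) hrs hreg).2
  rw [frobeniusPower_eq_map, ← hrs, Ideal.map_ofList]
  change Module.length R (R ⧸ Ideal.ofList (rs.map (· ^ p ^ e))) = _
  rw [h, hl, pow_mul]

/-- Flatness of the Frobenius in coordinates: multiplication by `x^{p^e}` is the scalar `x` on
`F^e_*R`, so it acts on each coordinate separately. -/
theorem colon_frobeniusPower (h : (frobenius R p).Finite) (e : ℕ) (I : Ideal R) (x : R) :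
    Submodule.colon (frobeniusPower p I e) {x ^ p ^ e} =
      frobeniusPower p (Submodule.colon I {x}) e := by
  have := free_frobAlg h e
  have := FrobAlg.finite h e
  let b := Module.Free.chooseBasis R (FrobAlg p e R)
  ext y
  rw [Submodule.mem_colon_singleton, smul_eq_mul, mem_frobeniusPower, mem_frobeniusPower,
    mul_comm, ← FrobAlg.smul_of, mem_map_iff_repr b, mem_map_iff_repr b]
  refine forall_congr' fun i => ?_
  rw [Submodule.mem_colon_singleton, map_smul, Finsupp.smul_apply, smul_eq_mul, smul_eq_mul,
    mul_comm]

end Regular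

/-! ### Lengths: annihilated modules, cokernels, restriction of scalars -/

section Length

theorem length_quotient_pi {A : Type u} [CommRing A] (I : Ideal A) (n : ℕ) :
    Module.length A ((Fin n → A) ⧸ Submodule.pi Set.univ (fun _ : Fin n => I)) =
      n * Module.length A (A ⧸ I) := by
  rw [(Submodule.quotientPi (fun _ : Fin n => I)).length_eq, Module.length_pi_of_fintype]
  simp

theorem length_le_of_annihilated {A : Type u} [CommRing A] {C : Type v} [AddCommGroup C]
    [Module A C] (I : Ideal A) {n : ℕ} (v : Fin n → C) (hv : Submodule.span A (Set.range v) = ⊤)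
    (hI : ∀ a ∈ I, ∀ x : C, a • x = 0) :
    Module.length A C ≤ n * Module.length A (A ⧸ I) := by
  rw [← length_quotient_pi]
  let F : (Fin n → A) →ₗ[A] C := Fintype.linearCombination A v
  have hker : Submodule.pi Set.univ (fun _ : Fin n => I) ≤ LinearMap.ker F := by
    intro c hc
    rw [LinearMap.mem_ker]
    rw [Fintype.linearCombination_apply]
    exact Finset.sum_eq_zero fun i _ => hI _ (hc i trivial) _
  refine Module.length_le_of_surjective (Submodule.liftQ _ F hker) ?_
  rw [← LinearMap.range_eq_top, Submodule.range_liftQ, Fintype.range_linearCombination, hv]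

/-- A comparison of colengths along a linear map whose cokernel is killed by `g`. -/
theorem length_quotient_le_add {A : Type u} [CommRing A] {M N : Type v} [AddCommGroup M]
    [Module A M] [AddCommGroup N] [Module A N] (φ : M →ₗ[A] N) {M' : Submodule A M}
    {N' : Submodule A N} (h : M' ≤ N'.comap φ) {I : Ideal A} (hI : I • (⊤ : Submodule A N) ≤ N')
    {g : A} (hg : ∀ x : N, g • x ∈ LinearMap.range φ) {n : ℕ} (v : Fin n → N)
    (hv : Submodule.span A (Set.range v) = ⊤) :
    Module.length A (N ⧸ N') ≤
      Module.length A (M ⧸ M') + n * Module.length A (A ⧸ (I ⊔ Ideal.span {g})) := by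
  let φ' := Submodule.mapQ M' N' φ h
  rw [Module.length_eq_add_of_exact (LinearMap.range φ').subtype (LinearMap.range φ').mkQ
    (Submodule.subtype_injective _) (Submodule.mkQ_surjective _)
    (LinearMap.exact_subtype_mkQ _)]
  refine add_le_add (Module.length_le_of_surjective φ'.rangeRestrict φ'.surjective_rangeRestrict) ?_
  let π : N →ₗ[A] ((N ⧸ N') ⧸ LinearMap.range φ') := (LinearMap.range φ').mkQ ∘ₗ N'.mkQ
  have hπ : Function.Surjective π :=
    (Submodule.mkQ_surjective _).comp (Submodule.mkQ_surjective _)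
  refine length_le_of_annihilated _ (π ∘ v) ?_ ?_
  · rw [Set.range_comp, ← Submodule.map_span, hv, Submodule.map_top, LinearMap.range_eq_top.2 hπ]
  · intro a ha x
    obtain ⟨x, rfl⟩ := hπ x
    obtain ⟨b, hb, c, hc, rfl⟩ := Submodule.mem_sup.1 ha
    obtain ⟨r, rfl⟩ := Ideal.mem_span_singleton'.1 hc
    have h1 : π (b • x) = 0 := by
      have : N'.mkQ (b • x) = 0 := (Submodule.Quotient.mk_eq_zero _).2
        (hI (Submodule.smul_mem_smul hb trivial))
      simp only [π, LinearMap.comp_apply, this, map_zero]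
    have h2 : π (g • x) = 0 := by
      obtain ⟨y, hy⟩ := hg x
      refine (Submodule.Quotient.mk_eq_zero _).2 ⟨Submodule.Quotient.mk y, ?_⟩
      rw [← hy]
      rfl
    rw [add_smul, mul_smul, ← map_smul, ← map_smul, h1, h2, smul_zero, add_zero]

/-- Lengths under restriction of scalars to a local ring. -/
theorem length_restrictScalars {A : Type u} {B : Type v} [CommRing A] [CommRing B] [IsLocalRing B]
    [Algebra A B] {M : Type*} [AddCommGroup M] [Module B M] (h : IsFiniteLength B M) :
    ∀ [Module A M] [IsScalarTower A B M],
      Module.length A M = Module.length A (B ⧸ maximalIdeal B) * Module.length B M := by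
  induction h with
  | of_subsingleton => intro _ _; simp
  | @of_simple_quotient M _ _ N hs _ ih =>
    intro _ _
    have e1 := Module.length_eq_add_of_exact N.subtype N.mkQ N.subtype_injective
      N.mkQ_surjective (LinearMap.exact_subtype_mkQ N)
    have e2 := Module.length_eq_add_of_exact (N.subtype.restrictScalars A) (N.mkQ.restrictScalars A)
      N.subtype_injective N.mkQ_surjective (LinearMap.exact_subtype_mkQ N)
    obtain ⟨I, hI, ⟨eq⟩⟩ := isSimpleModule_iff_quot_maximal.1 hs
    obtain rfl := eq_maximalIdeal hI
    rw [e1, e2, ih, (eq.restrictScalars A).length_eq, Module.length_eq_one B (M ⧸ N), mul_add, mul_one]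

theorem length_quotient_restrictScalars (A : Type u) {B : Type v} [CommRing A] [CommRing B]
    [IsLocalRing B] [Algebra A B] {I : Ideal B} (h : Module.length B (B ⧸ I) ≠ ⊤) :
    Module.length A (B ⧸ I) =
      Module.length A (B ⧸ maximalIdeal B) * Module.length B (B ⧸ I) :=
  length_restrictScalars (Module.length_ne_top_iff.1 h)

end Length

/-! ### Lengths over the Frobenius and residue degrees -/

/-- An ideal of `A`, as an ideal of `F^e_* A`. -/
def FrobAlg.ideal (p e : ℕ) {A : Type u} [CommRing A] (I : Ideal A) : Ideal (FrobAlg p e A) := I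

section FrobLength

variable {p : ℕ} {A : Type u} [CommRing A] [ExpChar A p]

/-- The degree of the `e`-th Frobenius of the residue field. -/
noncomputable def residueLength (p e : ℕ) (A : Type u) [CommRing A] [ExpChar A p] [IsLocalRing A] :
    ℕ∞ :=
  Module.length A (FrobAlg p e A ⧸ maximalIdeal (FrobAlg p e A))

theorem length_frobAlg_quotient [IsLocalRing A] (e : ℕ) {I : Ideal A}
    (hI : Module.length A (A ⧸ I) ≠ ⊤) :
    Module.length A (FrobAlg p e A ⧸ FrobAlg.ideal p e I) =
      residueLength p e A * Module.length A (A ⧸ I) := by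
  exact length_quotient_restrictScalars A (B := FrobAlg p e A) (I := FrobAlg.ideal p e I) hI

theorem residueLength_eq_finrank [IsLocalRing A] [ExpChar (ResidueField A) p]
    (h : (frobenius (ResidueField A) p).Finite) (e : ℕ) :
    residueLength p e A = Module.finrank (ResidueField A) (FrobAlg p e (ResidueField A)) := by
  have := FrobAlg.finite h e
  rw [← Module.length_eq_finrank]
  let : Algebra A (FrobAlg p e (ResidueField A)) :=
    ((algebraMap (ResidueField A) (FrobAlg p e (ResidueField A))).comp (residue A)).toAlgebra
  have : IsScalarTower A (ResidueField A) (FrobAlg p e (ResidueField A)) :=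
    IsScalarTower.of_algebraMap_eq fun _ => rfl
  rw [← Module.length_eq_of_surjective (S := A) (R := ResidueField A)
    (M := FrobAlg p e (ResidueField A)) (residue_surjective)]
  refine LinearEquiv.length_eq (R := A)
    { (AddEquiv.refl _ : (FrobAlg p e A ⧸ maximalIdeal (FrobAlg p e A)) ≃+ 
        FrobAlg p e (ResidueField A)) with map_smul' := ?_ }
  intro a x
  obtain ⟨x, rfl⟩ := Ideal.Quotient.mk_surjective x
  exact (map_mul (residue A) (a ^ p ^ e) (show A from x)).trans
    (congrArg (· * _) (map_pow (residue A) a (p ^ e)))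

/-- The degrees of the iterates of the Frobenius of an F-finite field are the powers of a power of
the characteristic. -/
theorem exists_finrank_frobAlg (K : Type u) [Field K] [ExpChar K p]
    (h : (frobenius K p).Finite) :
    ∃ γ : ℕ, ∀ e, Module.finrank K (FrobAlg p e K) = p ^ (γ * e) := by
  have h1 := FrobAlg.finite h 1
  have hpi : IsPurelyInseparable K (FrobAlg p 1 K) := by
    rw [isPurelyInseparable_iff_pow_mem K p]
    exact fun x => ⟨1, x, rfl⟩
  obtain ⟨γ, hγ⟩ := IsPurelyInseparable.finrank_eq_pow (F := K) (FrobAlg p 1 K) p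
  refine ⟨γ, fun e => ?_⟩
  induction e with
  | zero =>
    have e0 : K ≃ₗ[K] FrobAlg p 0 K :=
      { (AddEquiv.refl K : K ≃+ FrobAlg p 0 K) with
        map_smul' := fun a x => by
          change a * x = a ^ p ^ 0 * x
          rw [pow_zero, pow_one] }
    rw [← e0.finrank_eq]
    simp
  | succ e ih =>
    -- In the tower `K → F_*K → F^{e+1}_*K` the upper extension is a copy of `K → F^e_*K`, so
    -- degrees multiply.
    let : Algebra (FrobAlg p 1 K) (FrobAlg p (e + 1) K) := (iterateFrobenius K p e).toAlgebra
    have : IsScalarTower K (FrobAlg p 1 K) (FrobAlg p (e + 1) K) :=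
      IsScalarTower.of_algebraMap_eq fun x => by
        change x ^ p ^ (e + 1) = (x ^ p ^ 1) ^ p ^ e
        rw [← pow_mul, pow_one, pow_succ']
    have e1 : Module.finrank (FrobAlg p 1 K) (FrobAlg p (e + 1) K) =
        Module.finrank K (FrobAlg p e K) := rfl
    rw [← Module.finrank_mul_finrank K (FrobAlg p 1 K) (FrobAlg p (e + 1) K), e1, ih, hγ,
      ← pow_add, Nat.mul_succ, add_comm]

theorem smul_top_eq_ideal (e : ℕ) (I : Ideal A) :
    (I • (⊤ : Submodule A (FrobAlg p e A))) =
      (FrobAlg.ideal p e (frobeniusPower p I e)).restrictScalars A := by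
  rw [Ideal.smul_top_eq_map]
  rfl

end FrobLength

theorem expChar_quotient {p : ℕ} [hp : Fact p.Prime] {A : Type u} [CommRing A] [ExpChar A p]
    {I : Ideal A} (hI : I ≠ ⊤) : ExpChar (A ⧸ I) p := by
  have : Nontrivial (A ⧸ I) := Ideal.Quotient.nontrivial_iff.2 hI
  have h0 : (p : A) = 0 := by
    cases ‹ExpChar A p› with
    | zero => exact absurd hp.out Nat.not_prime_one
    | prime _ => exact CharP.cast_eq_zero A p
  have : CharP (A ⧸ I) p := (CharP.charP_iff_prime_eq_zero hp.out).2 (by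
    rw [← map_natCast (Ideal.Quotient.mk I), h0, map_zero])
  exact ExpChar.prime hp.out

theorem finite_frobenius_residueField {p : ℕ} {A : Type u} [CommRing A] [IsLocalRing A]
    [ExpChar A p] [hk : ExpChar (ResidueField A) p] (h : (frobenius A p).Finite) :
    (frobenius (ResidueField A) p).Finite := by
  have : ExpChar (A ⧸ maximalIdeal A) p := hk
  exact FrobAlg.finite_frobenius_quotient h (maximalIdeal A)

/-! ### Colengths of Frobenius powers -/

section Regular

variable {R : Type u} [CommRing R] [IsRegularLocalRing R] {p : ℕ} [ExpChar R p]

/-- The `R`-length of `F^e_*(R/I^{[p^e]})` is computed twice: by restriction of scalars along the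
Frobenius, and as a direct sum of copies of `R/I` by freeness. -/
theorem residueLength_mul_length (h : (frobenius R p).Finite) (e : ℕ) {I : Ideal R}
    (hI : Module.length R (R ⧸ frobeniusPower p I e) ≠ ⊤) :
    residueLength p e R * Module.length R (R ⧸ frobeniusPower p I e) =
      Module.finrank R (FrobAlg p e R) * Module.length R (R ⧸ I) := by
  have := free_frobAlg h e
  have := FrobAlg.finite h e
  let b := Module.finBasis R (FrobAlg p e R)
  rw [← length_frobAlg_quotient e hI, ← length_quotient_pi]
  let E : (FrobAlg p e R ⧸ FrobAlg.ideal p e (frobeniusPower p I e)) ≃ₗ[R]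
      (FrobAlg p e R ⧸ (FrobAlg.ideal p e (frobeniusPower p I e)).restrictScalars R) :=
    (Submodule.Quotient.restrictScalarsEquiv R _).symm
  rw [E.length_eq]
  refine (Submodule.Quotient.equiv _ _ b.equivFun ?_).length_eq
  ext x
  obtain ⟨x, rfl⟩ := b.equivFun.surjective x
  rw [Submodule.mem_map_equiv, LinearEquiv.symm_apply_apply, Submodule.mem_pi]
  simp only [Set.mem_univ, forall_const]
  exact mem_map_iff_repr b

/-- The case `I = 𝔪`, known from the regular sequence, expresses the rank of `F^e_*R` through the
residue degree, which then cancels because it is finite and nonzero. -/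
theorem length_quotient_frobeniusPower [Fact p.Prime] (h : (frobenius R p).Finite) (e : ℕ) {I : Ideal R}
    (hI : Module.length R (R ⧸ frobeniusPower p I e) ≠ ⊤) :
    Module.length R (R ⧸ frobeniusPower p I e) =
      (p ^ (e * dimNat R) : ℕ) * Module.length R (R ⧸ I) := by
  have hm : Module.length R (R ⧸ frobeniusPower p (maximalIdeal R) e) ≠ ⊤ := by
    rw [length_quotient_frobeniusPower_maximalIdeal]
    exact ENat.natCast_ne_top _
  have h1 := residueLength_mul_length h e hm
  have hs : IsSimpleModule R (R ⧸ maximalIdeal R) := by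
    rw [isSimpleModule_iff_isCoatom]
    exact (maximalIdeal.isMaximal R).out
  rw [length_quotient_frobeniusPower_maximalIdeal, Module.length_eq_one, mul_one] at h1
  have h2 := residueLength_mul_length h e hI
  rw [← h1, mul_assoc] at h2
  have : ExpChar (ResidueField R) p :=
    expChar_quotient (maximalIdeal.isMaximal R).ne_top
  have hα0 : residueLength p e R ≠ 0 := by
    rw [residueLength, Ne, Module.length_eq_zero_iff, not_subsingleton_iff_nontrivial]
    exact Ideal.Quotient.nontrivial_iff.2 (maximalIdeal.isMaximal _).ne_top
  have hα : residueLength p e R ≠ ⊤ := by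
    rw [residueLength_eq_finrank (finite_frobenius_residueField h)]
    exact ENat.natCast_ne_top _
  exact (ENat.mul_right_strictMono hα0 hα).injective h2

end Regular

/-! ### Rank of the Frobenius of a domain and the length comparison -/

section Rank

/-- Equal ranks make the cokernel torsion; being finitely generated, it is killed by a single
nonzero element. -/
theorem exists_smul_mem_range {A : Type u} [CommRing A] [IsDomain A] {M N : Type v}
    [AddCommGroup M] [Module A M] [Module.Finite A M] [AddCommGroup N] [Module A N]
    [Module.Finite A N] (φ : M →ₗ[A] N) (hφ : Function.Injective φ)
    (h : Module.finrank A M = Module.finrank A N) :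
    ∃ g : A, g ≠ 0 ∧ ∀ x : N, g • x ∈ LinearMap.range φ := by
  have h1 := Submodule.finrank_quotient_add_finrank (LinearMap.range φ)
  rw [← (LinearEquiv.ofInjective φ hφ).finrank_eq, h] at h1
  have h2 : Module.finrank A (N ⧸ LinearMap.range φ) = 0 := by omega
  obtain ⟨g, hg1, hg2⟩ := Submodule.annihilator_top_inter_nonZeroDivisors
    (Module.finrank_eq_zero_iff_isTorsion.1 h2)
  refine ⟨g, nonZeroDivisors.ne_zero hg2, fun x => ?_⟩
  have := Submodule.mem_annihilator.1 hg1 (Submodule.Quotient.mk x) trivial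
  rwa [← Submodule.Quotient.mk_smul, Submodule.Quotient.mk_eq_zero] at this

variable {p : ℕ} {D : Type u} [CommRing D] [ExpChar D p]

theorem finrank_frobAlg_fractionRing (K : Type u) [Field K] [Algebra D K] [IsFractionRing D K]
    [ExpChar K p] (e : ℕ) :
    Module.finrank K (FrobAlg p e K) = Module.finrank D (FrobAlg p e D) := by
  let : Algebra (FrobAlg p e D) (FrobAlg p e K) := inferInstanceAs (Algebra D K)
  have : IsFractionRing (FrobAlg p e D) (FrobAlg p e K) := ‹IsFractionRing D K›
  let : Algebra D (FrobAlg p e K) :=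
    ((algebraMap K (FrobAlg p e K)).comp (algebraMap D K)).toAlgebra
  have : IsScalarTower D K (FrobAlg p e K) := IsScalarTower.of_algebraMap_eq fun _ => rfl
  have : IsScalarTower D (FrobAlg p e D) (FrobAlg p e K) :=
    IsScalarTower.of_algebraMap_eq fun x => (map_pow (algebraMap D K) x (p ^ e)).symm
  exact IsFractionRing.finrank_eq D K (FrobAlg p e D) (FrobAlg p e K)

variable [IsDomain D]

theorem FrobAlg.algebraMap_injective (e : ℕ) :
    Function.Injective (algebraMap D (FrobAlg p e D)) :=
  iterateFrobenius_inj D p e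

instance (e : ℕ) : Module.IsTorsionFree D (FrobAlg p e D) :=
  Module.isTorsionFree_iff_algebraMap_injective.2 (FrobAlg.algebraMap_injective e)

/-- The rank is unchanged on passing to the fraction field, where the field case applies;
F-finiteness there follows from positivity of the rank. -/
theorem exists_finrank_frobAlg_of_isDomain (h : (frobenius D p).Finite) :
    ∃ γ : ℕ, ∀ e, Module.finrank D (FrobAlg p e D) = p ^ (γ * e) := by
  let K := FractionRing D
  have : ExpChar K p := expChar_of_injective_algebraMap (IsFractionRing.injective D K) p
  have key : ∀ e, Module.finrank K (FrobAlg p e K) = Module.finrank D (FrobAlg p e D) :=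
    finrank_frobAlg_fractionRing K
  have hfin : (frobenius K p).Finite := by
    have h1 := FrobAlg.finite h 1
    have h2 : Module.Finite K (FrobAlg p 1 K) := by
      refine Module.finite_of_finrank_pos ?_
      rw [key]
      exact Module.finrank_pos
    have h3 : (iterateFrobenius K p 1).Finite := h2
    rwa [iterateFrobenius_one] at h3
  obtain ⟨γ, hγ⟩ := exists_finrank_frobAlg K hfin
  exact ⟨γ, fun e => (key e).symm.trans (hγ e)⟩

/-- The change of the colength under a splitting of the Frobenius of a domain. -/
theorem exists_length_estimate [IsLocalRing D] (h : (frobenius D p).Finite) (e : ℕ)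
    (ψ : FrobAlg p e D →ₗ[D] D) (hψ : ψ 1 = 1) :
    ∃ g : D, g ≠ 0 ∧ ∃ n : ℕ, ∀ I J : Ideal D, frobeniusPower p I e ≤ J →
      (∀ x ∈ J, ψ (FrobAlg.of p e D x) ∈ I) → Module.length D (D ⧸ J) ≠ ⊤ →
      residueLength p e D * Module.length D (D ⧸ J) ≤
        Module.finrank D (FrobAlg p e D) * Module.length D (D ⧸ I) +
          n * Module.length D (D ⧸ (I ⊔ Ideal.span {g})) ∧
      Module.finrank D (FrobAlg p e D) * Module.length D (D ⧸ I) ≤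
        residueLength p e D * Module.length D (D ⧸ J) +
          n * Module.length D (D ⧸ (I ⊔ Ideal.span {g})) := by
  set B := FrobAlg p e D
  set ρ := Module.finrank D B
  have := FrobAlg.finite h e
  obtain ⟨b, hb⟩ : ∃ b : Fin ρ → B, LinearIndependent D b := by
    obtain ⟨t, ht, hli⟩ := exists_finset_linearIndependent_of_le_finrank (R := D) (M := B) le_rfl
    exact ⟨_, hli.comp _ (t.equivFinOfCardEq ht).symm.injective⟩
  let Φ : (Fin ρ → D) →ₗ[D] B := Fintype.linearCombination D b
  have hΦ : Function.Injective Φ := linearIndependent_iff_injective_fintypeLinearCombination.1 hb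
  obtain ⟨g₁, hg₁, hg₁'⟩ := exists_smul_mem_range Φ hΦ (by simp [ρ])
  -- `Φ` carries `I^ρ` into `J` and gives the first inequality. For the reverse one the splitting is
  -- needed: `y ↦ (ψ(b_i y))_i` carries `J` into `I^ρ`.
  let Ψ : B →ₗ[D] (Fin ρ → D) := LinearMap.pi fun i => ψ ∘ₗ LinearMap.mulLeft D (b i)
  have hψa : ∀ y : D, ψ (algebraMap D B y) = y := fun y => by
    rw [Algebra.algebraMap_eq_smul_one, map_smul, hψ, smul_eq_mul, mul_one]
  have hΨ : Function.Injective Ψ := by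
    rw [injective_iff_map_eq_zero]
    intro y hy
    have h1 : ∀ c : Fin ρ → D, ψ (Φ c * y) = 0 := by
      intro c
      rw [Fintype.linearCombination_apply, Finset.sum_mul, map_sum]
      refine Finset.sum_eq_zero fun i _ => ?_
      rw [smul_mul_assoc, map_smul, show ψ (b i * y) = 0 from congrFun hy i, smul_zero]
    have h2 : ∀ x : B, ψ (x * y) = 0 := by
      intro x
      obtain ⟨c, hc⟩ := hg₁' x
      have := h1 c
      rw [hc, smul_mul_assoc, map_smul, smul_eq_mul] at this
      exact (mul_eq_zero.1 this).resolve_left hg₁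
    -- This multiplier turns `y` into `y^{p^e}`, the image of the scalar `y`, on which `ψ` returns
    -- `y`; hence `y = 0`.
    have h3 := h2 (y ^ (p ^ e - 1))
    have h4 : y ^ (p ^ e - 1) * y = algebraMap D B y := by
      rw [← pow_succ, Nat.sub_add_cancel (pow_pos_of_expChar (A := D) e)]
      rfl
    rw [h4] at h3
    exact (hψa y).symm.trans h3
  obtain ⟨g₂, hg₂, hg₂'⟩ := exists_smul_mem_range Ψ hΨ (by simp [ρ])
  obtain ⟨μ, v, hv⟩ := Module.Finite.exists_fin (R := D) (M := B)
  refine ⟨g₁ * g₂, mul_ne_zero hg₁ hg₂, max μ ρ, fun I J hIJ hJI hJ => ?_⟩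
  have hE : Module.length D (B ⧸ (FrobAlg.ideal p e J).restrictScalars D) =
      residueLength p e D * Module.length D (D ⧸ J) := by
    rw [← length_frobAlg_quotient e hJ]
    exact (Submodule.Quotient.restrictScalarsEquiv D (FrobAlg.ideal p e J)).length_eq
  have hle : I • (⊤ : Submodule D B) ≤ (FrobAlg.ideal p e J).restrictScalars D := by
    rw [smul_top_eq_ideal]
    exact hIJ
  constructor
  · rw [← hE, ← length_quotient_pi]
    refine (length_quotient_le_add Φ (M' := Submodule.pi Set.univ (fun _ : Fin ρ => I))
      (fun c hc => ?_) hle (g := g₁ * g₂) (fun x => ?_) v hv).trans ?_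
    · rw [Submodule.mem_comap, Fintype.linearCombination_apply]
      exact Submodule.sum_mem _ fun i _ => hle (Submodule.smul_mem_smul (hc i trivial) trivial)
    · rw [mul_comm, mul_smul]
      exact Submodule.smul_mem _ _ (hg₁' x)
    · gcongr
      exact le_max_left _ _
  · rw [← hE, ← length_quotient_pi]
    refine (length_quotient_le_add Ψ (M' := (FrobAlg.ideal p e J).restrictScalars D)
      (N' := Submodule.pi Set.univ (fun _ : Fin ρ => I))
      (fun x hx => ?_) (I := I) ?_ (g := g₁ * g₂) (fun x => ?_) (fun i => Pi.single i 1) ?_).trans ?_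
    · intro i _
      exact hJI _ ((FrobAlg.ideal p e J).mul_mem_left (b i) hx)
    · refine Submodule.smul_le.2 fun r hr c _ i _ => ?_
      exact I.mul_mem_right _ hr
    · rw [mul_smul]
      exact Submodule.smul_mem _ _ (hg₂' x)
    · have h0 : (fun i => Pi.single i 1 : Fin ρ → Fin ρ → D) = Pi.basisFun D (Fin ρ) :=
        funext fun i => (Pi.basisFun_apply D (Fin ρ) i).symm
      rw [h0]
      exact (Pi.basisFun D (Fin ρ)).span_eq
    · gcongr
      exact le_max_right _ _

end Rank

/-! ### Asymptotics of an almost geometric sequence -/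

section Real

/-- The normalized terms have consecutive ratios `1 + ε k` with `ε` dominated by a geometric series.
The sum of the logarithms therefore converges, and its exponential gives a strictly positive limit.
-/
theorem exists_tendsto_div_pow {u : ℕ → ℝ} (hu : ∀ k, 0 < u k) {α ρ C q : ℝ} (hα : 0 < α)
    (hρ : 0 < ρ) (hq : 1 < q)
    (h : ∀ k, |α * u (k + 1) - ρ * u k| ≤ C * u k / q ^ k) :
    ∃ r : ℝ, 0 < r ∧ Tendsto (fun k => u k / (ρ / α) ^ k) atTop (𝓝 r) := by
  have hθ : 0 < ρ / α := div_pos hρ hα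
  set w : ℕ → ℝ := fun k => u k / (ρ / α) ^ k with hw
  have hwpos : ∀ k, 0 < w k := fun k => div_pos (hu k) (pow_pos hθ k)
  set ε : ℕ → ℝ := fun k => w (k + 1) / w k - 1 with hε
  have hεb : ∀ k, |ε k| ≤ C / ρ * (1 / q) ^ k := by
    intro k
    have h1 : ε k = (α * u (k + 1) - ρ * u k) / (ρ * u k) := by
      have := (hu k).ne'
      simp only [hε, hw, pow_succ]
      field_simp
    rw [h1, abs_div, abs_of_pos (mul_pos hρ (hu k)), div_le_iff₀ (mul_pos hρ (hu k))]
    refine (h k).trans (le_of_eq ?_)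
    have : q ≠ 0 := by positivity
    field_simp
    rw [mul_assoc, ← mul_pow, mul_one_div_cancel this, one_pow, mul_one]
  have hsum : Summable ε := by
    refine Summable.of_norm_bounded (g := fun k => C / ρ * (1 / q) ^ k) ?_ hεb
    refine (summable_geometric_of_lt_one (by positivity) ?_).mul_left _
    rw [div_lt_one (by positivity)]
    exact hq
  have hlog := Real.summable_log_one_add_of_summable hsum
  have hterm : ∀ k, Real.log (1 + ε k) = Real.log (w (k + 1)) - Real.log (w k) := by
    intro k
    rw [← Real.log_div (hwpos _).ne' (hwpos k).ne']
    simp [hε]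
  have ht := hlog.hasSum.tendsto_sum_nat
  simp only [hterm, Finset.sum_range_sub (fun k => Real.log (w k))] at ht
  have ht2 := (ht.add_const (Real.log (w 0))).rexp
  simp only [sub_add_cancel, Real.exp_log (hwpos _)] at ht2
  exact ⟨_, Real.exp_pos _, ht2⟩

end Real

/-! ### Colon ideals and Frobenius splittings -/

section PairIdeal

theorem colon_colon {R : Type u} [CommRing R] (I : Ideal R) (x y : R) :
    Submodule.colon (Submodule.colon I {x} : Ideal R) {y} = Submodule.colon I {x * y} := by
  ext z
  simp only [Submodule.mem_colon_singleton, smul_eq_mul]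
  rw [mul_assoc, mul_comm y x]

theorem colon_singleton_mono {R : Type u} [CommRing R] {I J : Ideal R} (h : I ≤ J) (x : R) :
    Submodule.colon I {x} ≤ Submodule.colon J {x} := fun _ hy =>
  Submodule.mem_colon_singleton.2 (h (Submodule.mem_colon_singleton.1 hy))

theorem le_colon_singleton {R : Type u} [CommRing R] (I : Ideal R) (x : R) :
    I ≤ Submodule.colon I {x} := fun _ hy =>
  Submodule.mem_colon_singleton.2 (I.mul_mem_right _ hy)

theorem length_quotient_anti {R : Type u} [CommRing R] {I J : Ideal R} (h : I ≤ J) :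
    Module.length R (R ⧸ J) ≤ Module.length R (R ⧸ I) :=
  Module.length_le_of_surjective (Submodule.factor h) (Submodule.factor_surjective h)

/-- If `(I : g^i) ≤ H` for `i < n`, then `n ℓ(R/(H + g)) ≤ ℓ(R/I)`. -/
theorem mul_length_le_of_colon_le {R : Type u} [CommRing R] {I H : Ideal R} {g : R} (n : ℕ)
    (h : ∀ i < n, Submodule.colon I {g ^ i} ≤ H) :
    n * Module.length R (R ⧸ (H ⊔ Ideal.span {g})) ≤ Module.length R (R ⧸ I) := by
  suffices n * Module.length R (R ⧸ (H ⊔ Ideal.span {g})) ≤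
      Module.length R (R ⧸ (I ⊔ Ideal.span {g ^ n})) from
    this.trans (length_quotient_anti le_sup_left)
  induction n with
  | zero => simp
  | succ n ih =>
    rw [length_quotient_sup_span_pow_succ, Nat.cast_succ, add_mul, one_mul, add_comm]
    -- The new layer is `R/((I + g^{n+1}) : g^n)`, and that colon lies in `(I : g^n) + (g) ⊆ H +
    -- (g)`.
    refine add_le_add (length_quotient_anti fun y hy => ?_) (ih fun i hi => h i (by omega))
    rw [Submodule.mem_colon_singleton, smul_eq_mul] at hy
    obtain ⟨a, ha, b, hb, hab⟩ := Submodule.mem_sup.1 hy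
    obtain ⟨r, rfl⟩ := Ideal.mem_span_singleton'.1 hb
    have h1 : y - r * g ∈ H := h n (by omega) (Submodule.mem_colon_singleton.2 (by
      have : (y - r * g) • g ^ n = a := by
        rw [smul_eq_mul, eq_sub_of_add_eq hab]
        ring
      rwa [this]))
    have : y = (y - r * g) + r * g := by ring
    rw [this]
    exact Submodule.add_mem_sup h1 (Ideal.mul_mem_left _ _ (Ideal.mem_span_singleton_self _))

variable {R : Type u} [CommRing R] [IsRegularLocalRing R] {p : ℕ} [ExpChar R p]

theorem pairIdeal_add (hF : (frobenius R p).Finite) (f : R) (e e' N N' : ℕ) :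
    pairIdeal p f (e + e') (N * p ^ e' + N') =
      Submodule.colon (frobeniusPower p (pairIdeal p f e N) e') {f ^ N'} := by
  rw [pairIdeal, pairIdeal, ← colon_frobeniusPower hF, frobeniusPower_add, colon_colon, ← pow_mul,
    ← pow_add]

/-- The Frobenius splits with `1 ↦ f^N` if `f^N ∉ 𝔪^{[p^e]}`. -/
theorem exists_splitting (hF : (frobenius R p).Finite) {x : R} {e : ℕ}
    (hx : x ∉ frobeniusPower p (maximalIdeal R) e) :
    ∃ φ : FrobAlg p e R →ₗ[R] R, φ (FrobAlg.of p e R x) = 1 := by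
  have := free_frobAlg hF e
  have := FrobAlg.finite hF e
  let b := Module.Free.chooseBasis R (FrobAlg p e R)
  rw [mem_frobeniusPower, mem_map_iff_repr b] at hx
  push Not at hx
  obtain ⟨i, hi⟩ := hx
  obtain ⟨u, hu⟩ := notMem_maximalIdeal.1 hi
  refine ⟨(↑u⁻¹ : R) • b.coord i, ?_⟩
  rw [LinearMap.smul_apply, Module.Basis.coord_apply, ← hu, smul_eq_mul, Units.inv_mul]

end PairIdeal

/-! ### The descending ideals and the splitting prime -/

/-- `K_e = q^{e-1} + ⋯ + q + 1`. -/
def geomSum (q e : ℕ) : ℕ := ∑ i ∈ Finset.range e, q ^ i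

theorem geomSum_add (q i j : ℕ) : geomSum q (i + j) = geomSum q j * q ^ i + geomSum q i := by
  rw [geomSum, geomSum, geomSum, Finset.sum_range_add, Finset.sum_mul, add_comm]
  congr 1
  exact Finset.sum_congr rfl fun k _ => by rw [pow_add, mul_comm]

/-- The ideals `(𝔪^{[q^k]} : f^{a K_k})`, where `q = p^s`. -/
def splitIdeal {R : Type u} [CommRing R] [IsLocalRing R] (p : ℕ) (f : R) (s a k : ℕ) : Ideal R :=
  pairIdeal p f (k * s) (a * geomSum (p ^ s) k)

section SplitIdeal

variable {R : Type u} [CommRing R] [IsLocalRing R] {p : ℕ} {f : R} {s a : ℕ}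

theorem splitIdeal_zero : splitIdeal p f s a 0 = maximalIdeal R := by
  ext x
  simp [splitIdeal, pairIdeal, geomSum, frobeniusPower_zero, Submodule.mem_colon_singleton]

theorem length_splitIdeal_ne_top [IsNoetherianRing R] (k : ℕ) : Module.length R (R ⧸ splitIdeal p f s a k) ≠ ⊤ :=
  pairLength_ne_top p f _ _

end SplitIdeal

section RegularSplitIdeal

variable {R : Type u} [CommRing R] [IsRegularLocalRing R] {p : ℕ} [ExpChar R p]
  (hF : (frobenius R p).Finite) {f : R} {s a : ℕ}
  (hfa : f ^ a ∉ frobeniusPower p (maximalIdeal R) s)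

include hF in
theorem splitIdeal_add (i j : ℕ) : splitIdeal p f s a (i + j) =
    Submodule.colon (frobeniusPower p (splitIdeal p f s a j) (i * s))
      {f ^ (a * geomSum (p ^ s) i)} := by
  rw [splitIdeal, splitIdeal, ← pairIdeal_add hF]
  congr 1
  · ring
  · rw [geomSum_add, ← pow_mul, mul_comm s i]
    ring

include hF in
theorem frobeniusPower_splitIdeal_le (i j : ℕ) :
    frobeniusPower p (splitIdeal p f s a j) (i * s) ≤ splitIdeal p f s a (i + j) := by
  rw [splitIdeal_add hF]
  exact le_colon_singleton _ _

-- The hypothesis on `f^a` says that `J_1` is proper, i.e. `J_1 ⊆ 𝔪 = J_0`; taking `q^k`-th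
-- Frobenius powers and then the colon by `f^{aK_k}` gives `J_{k+1} ⊆ J_k`.
include hF hfa in
theorem splitIdeal_antitone : Antitone (splitIdeal p f s a) := by
  refine antitone_nat_of_succ_le fun k => ?_
  have h1 : splitIdeal p f s a 1 ≤ splitIdeal p f s a 0 := by
    rw [splitIdeal_zero]
    refine le_maximalIdeal fun h => hfa ?_
    have := (Ideal.eq_top_iff_one _).1 h
    simpa [splitIdeal, pairIdeal, geomSum, Submodule.mem_colon_singleton] using this
  have h0 := splitIdeal_add hF (f := f) (s := s) (a := a) k 0
  rw [add_zero] at h0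
  rw [splitIdeal_add hF, h0]
  exact colon_singleton_mono (frobeniusPower_mono h1 _) _

-- A smaller exponent gives a smaller colon, so take `i = q^k`. Then the colon equals `((J_j :
-- g)^{[q^k]} : f^{aK_k})`, and `J_j : g` is proper, hence inside `𝔪`. This bound yields both the
-- primality of the intersection and the size of the error term.
include hF in
theorem colon_splitIdeal_le {g : R} {j : ℕ} (hg : g ∉ splitIdeal p f s a j) (k : ℕ) {i : ℕ}
    (hi : i ≤ p ^ (k * s)) :
    Submodule.colon (splitIdeal p f s a (k + j)) {g ^ i} ≤ splitIdeal p f s a k := by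
  have h1 : Submodule.colon (splitIdeal p f s a (k + j)) {g ^ i} ≤
      Submodule.colon (splitIdeal p f s a (k + j)) {g ^ p ^ (k * s)} := by
    obtain ⟨t, ht⟩ := Nat.exists_eq_add_of_le hi
    rw [ht, pow_add, ← colon_colon]
    exact le_colon_singleton _ _
  refine h1.trans ?_
  have h0 := splitIdeal_add hF (f := f) (s := s) (a := a) k 0
  rw [add_zero] at h0
  rw [splitIdeal_add hF k j, h0, colon_colon, mul_comm (f ^ _), ← colon_colon, colon_frobeniusPower hF,
    splitIdeal_zero]
  refine colon_singleton_mono (frobeniusPower_mono (le_maximalIdeal fun h => hg ?_) _) _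
  simpa [Submodule.mem_colon_singleton] using (Ideal.eq_top_iff_one _).1 h

/-- The splitting prime `⋂ (𝔪^{[q^k]} : f^{a K_k})`. -/
def splittingPrime (p : ℕ) (f : R) (s a : ℕ) : Ideal R := ⨅ k, splitIdeal p f s a k

-- If `x ∉ J_j` and `xy` lies in every `J_k`, then `y x^{q^i} ∈ J_{i+j}`, and the colon bound puts
-- `y` in `J_i`, for every `i`.
include hF in
theorem isPrime_splittingPrime : (splittingPrime p f s a).IsPrime := by
  constructor
  · intro h
    have : splittingPrime p f s a ≤ splitIdeal p f s a 0 := iInf_le _ 0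
    rw [h, splitIdeal_zero, top_le_iff] at this
    exact (maximalIdeal.isMaximal R).ne_top this
  · intro x y hxy
    by_contra! h
    simp only [splittingPrime, Submodule.mem_iInf, not_forall] at h
    obtain ⟨⟨j, hj⟩, ⟨i, hi⟩⟩ := h
    refine hi (colon_splitIdeal_le hF hj i le_rfl (Submodule.mem_colon_singleton.2 ?_))
    have h1 : x * y ∈ splitIdeal p f s a (i + j) := (Submodule.mem_iInf _).1 hxy _
    obtain ⟨t, ht⟩ := Nat.exists_eq_add_of_le' (pow_pos_of_expChar (A := R) (p := p) (i * s))
    rw [smul_eq_mul, ht, pow_succ', ← mul_assoc, mul_comm y x]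
    exact Ideal.mul_mem_right _ _ h1

theorem length_splitIdeal_add_le [Fact p.Prime] (hF : (frobenius R p).Finite) (k j : ℕ) :
    Module.length R (R ⧸ splitIdeal p f s a (k + j)) ≤
      (p ^ (j * s * dimNat R) : ℕ) * Module.length R (R ⧸ splitIdeal p f s a k) := by
  rw [add_comm k j]
  have h : Module.length R (R ⧸ frobeniusPower p (splitIdeal p f s a k) (j * s)) ≠ ⊤ := by
    have h1 : frobeniusPower p (maximalIdeal R) (k * s + j * s) ≤
        frobeniusPower p (splitIdeal p f s a k) (j * s) := by
      rw [← frobeniusPower_add]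
      exact frobeniusPower_mono (le_colon_singleton _ _) _
    refine ne_top_of_le_ne_top ?_ (length_quotient_anti h1)
    rw [length_quotient_frobeniusPower_maximalIdeal]
    exact ENat.natCast_ne_top _
  rw [← length_quotient_frobeniusPower hF _ h]
  exact length_quotient_anti (frobeniusPower_splitIdeal_le hF _ _)

end RegularSplitIdeal

/-! ### Passage to the quotient by the splitting prime and the limit -/

theorem length_quotient_map_mk {R : Type u} [CommRing R] {P I : Ideal R} (h : P ≤ I) :
    Module.length (R ⧸ P) ((R ⧸ P) ⧸ I.map (Ideal.Quotient.mk P)) = Module.length R (R ⧸ I) := by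
  rw [← Module.length_eq_of_surjective (S := R) (R := R ⧸ P) Ideal.Quotient.mk_surjective]
  exact (DoubleQuot.quotQuotEquivQuotOfLEₐ R h).toLinearEquiv.length_eq

/-- A map `F^e_* R → R` compatible with an ideal descends to the quotient. -/
theorem exists_linearMap_quotient {R : Type u} [CommRing R] {p e : ℕ} [ExpChar R p] {P : Ideal R}
    [ExpChar (R ⧸ P) p] (ψ : FrobAlg p e R →ₗ[R] R)
    (hψ : ∀ x ∈ P, ψ (FrobAlg.of p e R x) ∈ P) :
    ∃ ψ' : FrobAlg p e (R ⧸ P) →ₗ[R ⧸ P] (R ⧸ P), ∀ x : R,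
      ψ' (FrobAlg.of p e _ (Ideal.Quotient.mk P x)) =
        Ideal.Quotient.mk P (ψ (FrobAlg.of p e R x)) := by
  let F : (R ⧸ P) →+ (R ⧸ P) := QuotientAddGroup.map P.toAddSubgroup P.toAddSubgroup
    (ψ.toAddMonoidHom.comp (FrobAlg.of p e R : R →+ FrobAlg p e R)) hψ
  have hF : ∀ x : R, F (Ideal.Quotient.mk P x) = Ideal.Quotient.mk P (ψ (FrobAlg.of p e R x)) :=
    fun _ => rfl
  refine ⟨{ toFun := fun x => F x, map_add' := F.map_add, map_smul' := fun a x => ?_ }, hF⟩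
  obtain ⟨a, rfl⟩ := Ideal.Quotient.mk_surjective a
  obtain ⟨x, rfl⟩ := Ideal.Quotient.mk_surjective (I := P) x
  have : (Ideal.Quotient.mk P a • FrobAlg.of p e _ (Ideal.Quotient.mk P x) :
      FrobAlg p e (R ⧸ P)) = FrobAlg.of p e _ (Ideal.Quotient.mk P (a ^ p ^ e * x)) :=
    (FrobAlg.smul_of _ _).trans
      (congrArg (FrobAlg.of p e (R ⧸ P)) (by rw [map_mul, map_pow]))
  refine (congrArg F this).trans ((hF _).trans ?_)
  rw [← FrobAlg.smul_of, map_smul, smul_eq_mul, map_mul]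
  rfl

section Limit

variable {R : Type u} [CommRing R] [IsRegularLocalRing R] {p : ℕ} [Fact p.Prime] [ExpChar R p]

/-- The comparison of consecutive colengths of the ideals `(𝔪^{[q^k]} : f^{a K_k})`. -/
theorem exists_length_splitIdeal_estimate (hF : (frobenius R p).Finite) {f : R} {s a : ℕ}
    (hfa : f ^ a ∉ frobeniusPower p (maximalIdeal R) s) :
    ∃ γ δ n j : ℕ, ∃ g : R, g ∉ splitIdeal p f s a j ∧ ∀ k,
      (p ^ (δ * s) : ℕ) * Module.length R (R ⧸ splitIdeal p f s a (k + 1)) ≤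
        (p ^ (γ * s) : ℕ) * Module.length R (R ⧸ splitIdeal p f s a k) +
          n * Module.length R (R ⧸ (splitIdeal p f s a k ⊔ Ideal.span {g})) ∧
      (p ^ (γ * s) : ℕ) * Module.length R (R ⧸ splitIdeal p f s a k) ≤
        (p ^ (δ * s) : ℕ) * Module.length R (R ⧸ splitIdeal p f s a (k + 1)) +
          n * Module.length R (R ⧸ (splitIdeal p f s a k ⊔ Ideal.span {g})) := by
  set P := splittingPrime p f s a with hP
  set J := splitIdeal p f s a with hJ
  have hPJ : ∀ k, P ≤ J k := fun k => iInf_le _ k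
  have hprime : P.IsPrime := isPrime_splittingPrime hF
  have hE : ExpChar (R ⧸ P) p := expChar_quotient hprime.ne_top
  have hloc : IsLocalRing (R ⧸ P) :=
    IsLocalRing.of_surjective' (Ideal.Quotient.mk _) Ideal.Quotient.mk_surjective
  have hFD := FrobAlg.finite_frobenius_quotient hF P
  have hEκ : ExpChar (ResidueField (R ⧸ P)) p :=
    expChar_quotient (maximalIdeal.isMaximal (R ⧸ P)).ne_top
  obtain ⟨γ, hγ⟩ := exists_finrank_frobAlg_of_isDomain hFD
  have hFκ := finite_frobenius_residueField hFD
  obtain ⟨δ, hδ⟩ := exists_finrank_frobAlg (ResidueField (R ⧸ P)) hFκ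
  obtain ⟨φ, hφ⟩ := exists_splitting hF hfa
  -- The twist by `f^a` makes `ψ 1 = 1` and sends `J_{k+1}` into `J_k`; hence it preserves `P` and
  -- induces a Frobenius splitting of `R/P`.
  let ψ : FrobAlg p s R →ₗ[R] R := φ ∘ₗ LinearMap.mulLeft R (FrobAlg.of p s R (f ^ a))
  have hψJ : ∀ k, ∀ x ∈ J (k + 1), ψ (FrobAlg.of p s R x) ∈ J k := by
    intro k x hx
    rw [hJ, add_comm, splitIdeal_add hF, Submodule.mem_colon_singleton] at hx
    have h1 : x * f ^ a ∈ frobeniusPower p (J k) s := by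
      simpa [geomSum] using hx
    rw [mul_comm] at h1
    exact linearMap_mem_of_mem_map φ h1
  have hψP : ∀ x ∈ P, ψ (FrobAlg.of p s R x) ∈ P := fun x hx =>
    (Submodule.mem_iInf _).2 fun k => hψJ k x (hPJ _ hx)
  obtain ⟨ψ', hψ'⟩ := exists_linearMap_quotient ψ hψP
  have hone : ψ' 1 = 1 := by
    have h1 := hψ' 1
    have h2 : ψ (FrobAlg.of p s R 1) = 1 := by
      rw [map_one]
      simp only [ψ, LinearMap.comp_apply, LinearMap.mulLeft_apply, mul_one, hφ]
    rwa [h2, map_one, map_one] at h1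
  obtain ⟨g', hg', n, hn⟩ := exists_length_estimate hFD s ψ' hone
  obtain ⟨g, rfl⟩ := Ideal.Quotient.mk_surjective g'
  have hgP : g ∉ P := fun h => hg' (Ideal.Quotient.eq_zero_iff_mem.2 h)
  obtain ⟨j, hj⟩ : ∃ j, g ∉ J j := by
    simpa [hP, splittingPrime, Submodule.mem_iInf] using hgP
  refine ⟨γ, δ, n, j, g, hj, fun k => ?_⟩
  have hmap : ((J k ⊔ Ideal.span {g}).map (Ideal.Quotient.mk P)) =
      (J k).map (Ideal.Quotient.mk P) ⊔ Ideal.span {Ideal.Quotient.mk P g} := by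
    rw [Ideal.map_sup, Ideal.map_span, Set.image_singleton]
  have key := hn ((J k).map (Ideal.Quotient.mk P)) ((J (k + 1)).map (Ideal.Quotient.mk P))
    (Ideal.span_le.2 ?_) ?_ ?_
  · rwa [← hmap, length_quotient_map_mk (hPJ k), length_quotient_map_mk (hPJ (k + 1)),
      length_quotient_map_mk ((hPJ k).trans le_sup_left), hγ,
      residueLength_eq_finrank hFκ, hδ] at key
  · rintro _ ⟨x, hx, rfl⟩
    obtain ⟨x, hxJ, rfl⟩ := (Ideal.mem_map_iff_of_surjective _ Ideal.Quotient.mk_surjective).1 hx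
    change (Ideal.Quotient.mk P x) ^ p ^ s ∈ _
    rw [← map_pow]
    refine Ideal.mem_map_of_mem _ ?_
    have h1 := frobeniusPower_splitIdeal_le hF (f := f) (s := s) (a := a) 1 k
    rw [one_mul, add_comm] at h1
    exact h1 (pow_mem_frobeniusPower hxJ s)
  · intro x hx
    obtain ⟨x, hxJ, rfl⟩ := (Ideal.mem_map_iff_of_surjective _ Ideal.Quotient.mk_surjective).1 hx
    rw [hψ']
    exact Ideal.mem_map_of_mem _ (hψJ k x hxJ)
  · rw [length_quotient_map_mk (hPJ (k + 1))]
    exact length_splitIdeal_ne_top _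

/-- The colengths of the ideals `(𝔪^{[q^k]} : f^{a K_k})` grow like a power of `q^k`. -/
theorem exists_tendsto_length_splitIdeal (hF : (frobenius R p).Finite) {f : R} {s a : ℕ}
    (hs : 0 < s) (hfa : f ^ a ∉ frobeniusPower p (maximalIdeal R) s) :
    ∃ m : ℤ, ∃ r : ℝ, 0 < r ∧
      Tendsto (fun k => ((Module.length R (R ⧸ splitIdeal p f s a k)).toNat : ℝ) /
        ((p : ℝ) ^ (k * s)) ^ m) atTop (𝓝 r) := by
  obtain ⟨γ, δ, n, j, g, hg, hest⟩ := exists_length_splitIdeal_estimate hF hfa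
  have hp : 0 < (p : ℝ) := by exact_mod_cast expChar_pos R p
  have hp1 : 1 < (p : ℝ) := by exact_mod_cast (Fact.out : p.Prime).one_lt
  choose l hl using fun k => ENat.ne_top_iff_exists.1
    (length_splitIdeal_ne_top (p := p) (f := f) (s := s) (a := a) k)
  have hfin : ∀ k, Module.length R (R ⧸ (splitIdeal p f s a k ⊔ Ideal.span {g})) ≠ ⊤ := fun k =>
    ne_top_of_le_ne_top (length_splitIdeal_ne_top k) (length_quotient_anti le_sup_left)
  choose h hh using fun k => ENat.ne_top_iff_exists.1 (hfin k)
  have hlpos : ∀ k, 0 < l k := by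
    intro k
    have : Nontrivial (R ⧸ splitIdeal p f s a k) := by
      refine Ideal.Quotient.nontrivial_iff.2 fun htop => ?_
      have h1 := splitIdeal_antitone hF hfa (Nat.zero_le k)
      rw [htop, splitIdeal_zero, top_le_iff] at h1
      exact (maximalIdeal.isMaximal R).ne_top h1
    have h2 := Module.length_pos (R := R) (M := R ⧸ splitIdeal p f s a k)
    rw [← hl] at h2
    exact_mod_cast h2
  -- The error term is smaller than `l k` by a factor of order `q^k`: `q^k ℓ(R/(J_k+g)) ≤
  -- ℓ(R/J_{k+j}) ≤ q^{jd} ℓ(R/J_k)`.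
  have h1 : ∀ k, p ^ (k * s) * h k ≤ p ^ (j * s * dimNat R) * l k := by
    intro k
    have e1 := mul_length_le_of_colon_le (p ^ (k * s)) (fun i hi =>
      colon_splitIdeal_le hF hg k hi.le)
    have e2 := e1.trans (length_splitIdeal_add_le hF k j)
    rw [← hh, ← hl] at e2
    exact_mod_cast e2
  have h2 : ∀ k, |(p : ℝ) ^ (δ * s) * l (k + 1) - (p : ℝ) ^ (γ * s) * l k| ≤
      (n * (p : ℝ) ^ (j * s * dimNat R)) * l k / ((p : ℝ) ^ s) ^ k := by
    intro k
    obtain ⟨e1, e2⟩ := hest k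
    rw [← hh, ← hl, ← hl] at e1 e2
    have e1' : (p : ℝ) ^ (δ * s) * l (k + 1) ≤ (p : ℝ) ^ (γ * s) * l k + n * h k := by
      exact_mod_cast e1
    have e2' : (p : ℝ) ^ (γ * s) * l k ≤ (p : ℝ) ^ (δ * s) * l (k + 1) + n * h k := by
      exact_mod_cast e2
    have e3 : (p : ℝ) ^ (k * s) * h k ≤ (p : ℝ) ^ (j * s * dimNat R) * l k := by
      exact_mod_cast h1 k
    have e4 : n * (h k : ℝ) ≤ (n * (p : ℝ) ^ (j * s * dimNat R)) * l k / ((p : ℝ) ^ s) ^ k := by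
      rw [le_div_iff₀ (by positivity), ← pow_mul, mul_comm s k, mul_assoc, mul_assoc,
        mul_comm (h k : ℝ)]
      gcongr
    rw [abs_le]
    constructor <;> linarith
  obtain ⟨r, hr, hlim⟩ := exists_tendsto_div_pow (u := fun k => (l k : ℝ))
    (fun k => by exact_mod_cast hlpos k) (by positivity) (by positivity)
    (one_lt_pow₀ hp1 hs.ne') h2
  refine ⟨(γ : ℤ) - δ, r, hr, hlim.congr fun k => ?_⟩
  rw [← hl, ENat.toNat_natCast]
  congr 1
  rw [← zpow_natCast ((p : ℝ) ^ (γ * s) / (p : ℝ) ^ (δ * s)), ← zpow_natCast, ← zpow_natCast,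
    ← zpow_natCast, ← zpow_sub₀ hp.ne', ← zpow_mul, ← zpow_mul]
  congr 1
  push_cast
  ring

end Limit

/-! ### The F-pure threshold -/

section Threshold

variable {R : Type u} [CommRing R] [IsRegularLocalRing R] {p : ℕ} [ExpChar R p]

theorem isSharplyFPure_iff (hF : (frobenius R p).Finite) {f : R} {t : ℝ} :
    IsSharplyFPure p f t ↔
      ∃ e, 0 < e ∧ f ^ ⌈t * ((p : ℝ) ^ e - 1)⌉₊ ∉ frobeniusPower p (maximalIdeal R) e := by
  refine exists_congr fun e => and_congr_right fun _ => ⟨?_, fun h => ?_⟩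
  · rintro ⟨φ, hφ, h1⟩ hmem
    let φ' : FrobAlg p e R →ₗ[R] R :=
      { toFun := fun x => φ x, map_add' := φ.map_add, map_smul' := hφ }
    have h2 : φ' (FrobAlg.of p e R (f ^ ⌈t * ((p : ℝ) ^ e - 1)⌉₊)) ∈ maximalIdeal R :=
      linearMap_mem_of_mem_map φ' hmem
    have h3 : (1 : R) ∈ maximalIdeal R := h1 ▸ h2
    exact (maximalIdeal.isMaximal R).ne_top ((Ideal.eq_top_iff_one _).2 h3)
  · obtain ⟨φ, hφ⟩ := exists_splitting hF h
    exact ⟨φ.toAddMonoidHom.comp (FrobAlg.of p e R : R →+ FrobAlg p e R),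
      fun r x => φ.map_smul r (FrobAlg.of p e R x), hφ⟩

theorem fpt_le (hF : (frobenius R p).Finite) {f : R} {b : ℝ}
    (h : ∀ e, 0 < e → ∀ N : ℕ, f ^ N ∉ frobeniusPower p (maximalIdeal R) e →
      (N : ℝ) ≤ b * ((p : ℝ) ^ e - 1)) (hp : 1 < p) : fpt p f ≤ (b : EReal) := by
  refine sSup_le ?_
  rintro _ ⟨t, -, ht, rfl⟩
  obtain ⟨e, he, hmem⟩ := (isSharplyFPure_iff hF).1 ht
  have h1 := (Nat.le_ceil _).trans (h e he _ hmem)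
  have h2 : 0 < (p : ℝ) ^ e - 1 := by
    have : (1 : ℝ) < (p : ℝ) ^ e := one_lt_pow₀ (by exact_mod_cast hp) he.ne'
    linarith
  exact_mod_cast le_of_mul_le_mul_right h1 h2

/-- Testing F-purity at `t = N/(p^e-1)` makes the ceiling equal to `N`. -/
theorem le_mul_of_fpt (hF : (frobenius R p).Finite) {f : R} {c : ℝ} (hc : fpt p f = (c : EReal))
    (hp : 1 < p) {e N : ℕ} (he : 0 < e) (h : f ^ N ∉ frobeniusPower p (maximalIdeal R) e) :
    (N : ℝ) ≤ c * ((p : ℝ) ^ e - 1) := by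
  have h2 : 0 < (p : ℝ) ^ e - 1 := by
    have : (1 : ℝ) < (p : ℝ) ^ e := one_lt_pow₀ (by exact_mod_cast hp) he.ne'
    linarith
  rw [← div_le_iff₀ h2]
  have h3 : (((N : ℝ) / ((p : ℝ) ^ e - 1) : ℝ) : EReal) ≤ fpt p f := by
    refine le_sSup ⟨_, by positivity, (isSharplyFPure_iff hF).2 ⟨e, he, ?_⟩, rfl⟩
    rwa [div_mul_cancel₀ _ h2.ne', Nat.ceil_natCast]
  rw [hc] at h3
  exact_mod_cast h3

theorem frobeniusPower_maximalIdeal_le {A : Type u} [CommRing A] [IsLocalRing A] (p e : ℕ)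
    (hp : p ≠ 0) : frobeniusPower p (maximalIdeal A) e ≤ maximalIdeal A := by
  refine Ideal.span_le.2 ?_
  rintro _ ⟨x, hx, rfl⟩
  exact Ideal.pow_mem_of_mem _ hx _ (by positivity)

theorem mem_maximalIdeal_of_fpt (hF : (frobenius R p).Finite) {f : R} {c : ℝ}
    (hc : fpt p f = (c : EReal)) (hp : 1 < p) : f ∈ maximalIdeal R := by
  by_contra hf
  rw [notMem_maximalIdeal] at hf
  obtain ⟨N, hN⟩ := exists_nat_gt (c * ((p : ℝ) ^ 1 - 1))
  refine absurd (le_mul_of_fpt hF hc hp one_pos (N := N) fun h => ?_) (not_le.2 hN)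
  exact (mem_maximalIdeal _).1 (frobeniusPower_maximalIdeal_le p 1 (by omega) h) (hf.pow N)

/-- By Krull's intersection theorem `f ∉ 𝔪^{[p^e]}` for some `e`, and then `1 ≤ c(p^e-1)`. -/
theorem fpt_pos (hF : (frobenius R p).Finite) {f : R} (hf : f ≠ 0) {c : ℝ}
    (hc : fpt p f = (c : EReal)) (hp : 1 < p) : 0 < c := by
  obtain ⟨e, he⟩ : ∃ e, f ∉ frobeniusPower p (maximalIdeal R) e := by
    by_contra! h
    refine hf ?_
    have h1 := Ideal.iInf_pow_eq_bot_of_isLocalRing (maximalIdeal R)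
      (maximalIdeal.isMaximal R).ne_top
    rw [← Ideal.mem_bot, ← h1, Submodule.mem_iInf]
    intro e
    refine Ideal.pow_le_pow_right (Nat.lt_pow_self hp).le
      ((Ideal.span_le.2 ?_ : frobeniusPower p (maximalIdeal R) e ≤ maximalIdeal R ^ p ^ e) (h e))
    rintro _ ⟨x, hx, rfl⟩
    exact Ideal.pow_mem_pow hx _
  have he0 : 0 < e := by
    refine Nat.pos_of_ne_zero fun h => he ?_
    rw [h, frobeniusPower_zero]
    exact mem_maximalIdeal_of_fpt hF hc hp
  have h1 := le_mul_of_fpt hF hc hp he0 (N := 1) (by rwa [pow_one])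
  have h2 : 0 < (p : ℝ) ^ e - 1 := by
    have : (1 : ℝ) < (p : ℝ) ^ e := one_lt_pow₀ (by exact_mod_cast hp) he0.ne'
    linarith
  by_contra! h
  have := mul_nonpos_of_nonpos_of_nonneg h h2.le
  push_cast at h1
  linarith

theorem fpt_le_one (hF : (frobenius R p).Finite) {f : R} (hf : f ∈ maximalIdeal R) (hp : 1 < p) :
    fpt p f ≤ ((1 : ℝ) : EReal) := by
  refine fpt_le hF (fun e _ N h => ?_) hp
  have h1 : N < p ^ e := by
    by_contra! hN
    obtain ⟨t, rfl⟩ := Nat.exists_eq_add_of_le hN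
    rw [pow_add] at h
    exact h (Ideal.mul_mem_right _ _ (pow_mem_frobeniusPower hf e))
  have h2 : ((N + 1 : ℕ) : ℝ) ≤ ((p ^ e : ℕ) : ℝ) := Nat.cast_le.2 h1
  push_cast at h2
  linarith

theorem geomSum_mul (q e : ℕ) : (geomSum q e : ℝ) * ((q : ℝ) - 1) = (q : ℝ) ^ e - 1 := by
  rw [geomSum]
  push_cast
  exact geom_sum_mul _ _

theorem pow_notMem_of_pow_notMem (hF : (frobenius R p).Finite) {f : R} {s a : ℕ}
    (h : f ^ a ∉ frobeniusPower p (maximalIdeal R) s) (k : ℕ) :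
    f ^ (a * geomSum (p ^ s) k) ∉ frobeniusPower p (maximalIdeal R) (k * s) := by
  intro hmem
  have h1 := splitIdeal_antitone hF h (Nat.zero_le k)
  rw [splitIdeal_zero] at h1
  have h2 : (1 : R) ∈ splitIdeal p f s a k := by
    rw [splitIdeal, pairIdeal, Submodule.mem_colon_singleton, one_smul]
    exact hmem
  exact (maximalIdeal.isMaximal R).ne_top ((Ideal.eq_top_iff_one _).2 (h1 h2))

/-- Sharp F-purity at the threshold `c = a/(p^s-1)`. -/
theorem pow_notMem_of_fpt (hF : (frobenius R p).Finite) {f : R} (hf : f ≠ 0) {c : ℝ}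
    (hc : fpt p f = (c : EReal)) (hp : 1 < p) {a s : ℕ} (hs : 0 < s)
    (ha : c = (a : ℝ) / ((p : ℝ) ^ s - 1)) :
    f ^ a ∉ frobeniusPower p (maximalIdeal R) s := by
  intro hmem
  have hp1 : (1 : ℝ) < p := by exact_mod_cast hp
  have hp0 : (0 : ℝ) < p := by positivity
  have hs1 : 0 < (p : ℝ) ^ s - 1 := by
    have : (1 : ℝ) < (p : ℝ) ^ s := one_lt_pow₀ hp1 hs.ne'
    linarith
  have hcpos := fpt_pos hF hf hc hp
  have hapos : 0 < (a : ℝ) := by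
    rw [ha] at hcpos
    exact (div_pos_iff_of_pos_right hs1).1 hcpos
  -- If `f^a ∈ 𝔪^{[p^s]}`, the threshold is at most `a/p^s`, strictly less than `a/(p^s-1) = c`.
  have key : fpt p f ≤ (((a : ℝ) / (p : ℝ) ^ s : ℝ) : EReal) := by
    refine fpt_le hF (fun e he N hN => ?_) hp
    have he1 : (1 : ℝ) < (p : ℝ) ^ e := one_lt_pow₀ hp1 he.ne'
    have hb : ∀ k ≥ s, (N : ℝ) * (1 - (((p : ℝ) ^ e)⁻¹) ^ k) ≤
        (a : ℝ) / (p : ℝ) ^ s * ((p : ℝ) ^ e - 1) := by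
      intro k hk
      have hle : s ≤ k * e := hk.trans (Nat.le_mul_of_pos_right k he)
      obtain ⟨w, hw⟩ := Nat.exists_eq_add_of_le hle
      have h1 := pow_notMem_of_pow_notMem hF hN k
      -- With `ke = s + w`, the element `f^{a p^w}` lies in `𝔪^{[p^{ke}]}`, but iterating the
      -- hypothesis on `f^N` keeps `f^{N(p^{e(k-1)} + ⋯ + 1)}` outside it. Letting `k → ∞` gives the
      -- bound on `N`.
      have h2 : N * geomSum (p ^ e) k < a * p ^ w := by
        by_contra! hcon
        refine h1 ?_
        obtain ⟨t, ht⟩ := Nat.exists_eq_add_of_le hcon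
        rw [ht, pow_add, hw, pow_mul, ← frobeniusPower_add]
        exact Ideal.mul_mem_right _ _ (pow_mem_frobeniusPower hmem w)
      have h3 : (N : ℝ) * geomSum (p ^ e) k ≤ a * (p : ℝ) ^ w := by exact_mod_cast h2.le
      have h4 := geomSum_mul (p ^ e) k
      push_cast at h4
      have h5 : (N : ℝ) * (((p : ℝ) ^ e) ^ k - 1) ≤ a * (p : ℝ) ^ w * ((p : ℝ) ^ e - 1) := by
        rw [← h4, ← mul_assoc]
        exact mul_le_mul_of_nonneg_right h3 (by linarith)
      have h6 : ((p : ℝ) ^ e) ^ k = (p : ℝ) ^ s * (p : ℝ) ^ w := by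
        rw [← pow_mul, mul_comm, hw, pow_add]
      have h7 : (N : ℝ) * (1 - (((p : ℝ) ^ e)⁻¹) ^ k) =
          (N : ℝ) * (((p : ℝ) ^ e) ^ k - 1) / (((p : ℝ) ^ e) ^ k) := by
        rw [inv_pow]
        field_simp
      rw [h7, div_le_iff₀ (by positivity)]
      refine h5.trans (le_of_eq ?_)
      rw [h6]
      field_simp
    have hlim : Tendsto (fun k : ℕ => (N : ℝ) * (1 - (((p : ℝ) ^ e)⁻¹) ^ k)) atTop
        (𝓝 ((N : ℝ) * (1 - 0))) :=
      ((tendsto_pow_atTop_nhds_zero_of_lt_one (by positivity)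
        (inv_lt_one_of_one_lt₀ he1)).const_sub 1).const_mul _
    rw [sub_zero, mul_one] at hlim
    exact le_of_tendsto hlim (eventually_atTop.2 ⟨s, hb⟩)
  rw [hc, EReal.coe_le_coe_iff, ha, div_le_div_iff_of_pos_left hapos hs1 (by positivity)] at key
  linarith

end Threshold

/-! ### Periods of the denominator and a limsup along multiples -/

section Arithmetic

/-- Here `s` is the order of `p` modulo the denominator of `c`. The last clause records its
minimality, so that every other admissible exponent is a multiple of it. -/
theorem exists_mul_pow_sub_one {p : ℕ} (hp : p.Prime) {c : ℚ} (hden : ¬ p ∣ c.den) (hc : 0 ≤ c) :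
    ∃ s a : ℕ, 0 < s ∧ (c : ℝ) = (a : ℝ) / ((p : ℝ) ^ s - 1) ∧
      ∀ e N : ℕ, (N : ℝ) = (c : ℝ) * ((p : ℝ) ^ e - 1) → s ∣ e := by
  have hco : p.Coprime c.den := (Nat.Prime.coprime_iff_not_dvd hp).2 hden
  have : NeZero c.den := ⟨c.den_nz⟩
  have hord : 0 < orderOf (p : ZMod c.den) := by
    have h := orderOf_pos (ZMod.unitOfCoprime p hco)
    rwa [← orderOf_units, ZMod.coe_unitOfCoprime] at h
  have hiff : ∀ e : ℕ, orderOf (p : ZMod c.den) ∣ e ↔ (c.den : ℤ) ∣ (p : ℤ) ^ e - 1 := by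
    intro e
    rw [orderOf_dvd_iff_pow_eq_one, ← ZMod.intCast_zmod_eq_zero_iff_dvd]
    push_cast
    rw [sub_eq_zero]
  have hcnd : (c : ℝ) * (c.den : ℝ) = (c.num : ℝ) := by exact_mod_cast Rat.mul_den_eq_num c
  have hdpos : (0 : ℝ) < c.den := by exact_mod_cast c.den_pos
  set s := orderOf (p : ZMod c.den)
  obtain ⟨w, hw⟩ := (hiff s).1 dvd_rfl
  have hp1 : (1 : ℝ) < p := by exact_mod_cast hp.one_lt
  have hs1 : 0 < (p : ℝ) ^ s - 1 := by
    have : (1 : ℝ) < (p : ℝ) ^ s := one_lt_pow₀ hp1 hord.ne'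
    linarith
  have hwR : (p : ℝ) ^ s - 1 = (c.den : ℝ) * (w : ℝ) := by exact_mod_cast hw
  have hwpos : (0 : ℝ) < w := by
    rw [hwR] at hs1
    exact (pos_iff_pos_of_mul_pos hs1).1 hdpos
  have hnn : 0 ≤ c.num * w := mul_nonneg (Rat.num_nonneg.2 hc) (by exact_mod_cast hwpos.le)
  refine ⟨s, (c.num * w).toNat, hord, ?_, fun e N hN => ?_⟩
  · have h1 : (((c.num * w).toNat : ℕ) : ℝ) = (c.num : ℝ) * w := by
      have : (((c.num * w).toNat : ℕ) : ℤ) = c.num * w := Int.toNat_of_nonneg hnn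
      exact_mod_cast congrArg (Int.cast : ℤ → ℝ) this
    rw [h1, eq_div_iff hs1.ne', hwR, ← mul_assoc, hcnd]
  · rw [hiff]
    have h1 : c.num * ((p : ℤ) ^ e - 1) = N * c.den := by
      have : (c.num : ℝ) * ((p : ℝ) ^ e - 1) = N * c.den := by
        rw [hN, ← hcnd]
        ring
      exact_mod_cast this
    have h2 : IsCoprime (c.den : ℤ) c.num := by
      rw [Int.isCoprime_iff_nat_coprime, Int.natAbs_natCast]
      exact c.reduced.symm
    exact h2.dvd_of_dvd_mul_left (h1 ▸ Dvd.intro_left _ rfl)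

theorem limsup_eq_of_tendsto_mul {F : ℕ → ℝ≥0∞} {s : ℕ} (hs : 0 < s) (h0 : ∀ e, ¬ s ∣ e → F e = 0)
    {L : ℝ≥0∞} (hL : Tendsto (fun k => F (k * s)) atTop (𝓝 L)) : limsup F atTop = L := by
  apply le_antisymm
  · refine le_of_forall_gt_imp_ge_of_dense fun y hy => limsup_le_of_le (by isBoundedDefault) ?_
    obtain ⟨k₀, hk₀⟩ := eventually_atTop.1 (hL.eventually_lt_const hy)
    refine eventually_atTop.2 ⟨k₀ * s, fun e he => ?_⟩
    by_cases hd : s ∣ e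
    · obtain ⟨k, rfl⟩ := hd
      rw [mul_comm s k] at he ⊢
      exact (hk₀ k (Nat.le_of_mul_le_mul_right he hs)).le
    · rw [h0 e hd]
      exact zero_le
  · rw [← hL.limsup_eq]
    have hg : Tendsto (fun k : ℕ => k * s) atTop atTop := tendsto_id.atTop_mul_const' hs
    exact limsup_le_limsup_of_le (f := map (fun k : ℕ => k * s) atTop) (g := atTop) (u := F) hg
      (by isBoundedDefault) (by isBoundedDefault)

end Arithmetic

/-! ### The F-signature at exponents with `p`-power denominator -/

section Signature

variable {R : Type u} [CommRing R] [IsRegularLocalRing R] {p : ℕ} [hp : Fact p.Prime] [ExpChar R p]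

theorem pairLength_mul_pow (hF : (frobenius R p).Finite) (f : R) (e v N : ℕ) :
    pairLength p f (e + v) (N * p ^ v) = (p ^ (v * dimNat R) : ℕ) * pairLength p f e N := by
  have h1 := pairIdeal_add hF f e v N 0
  have h2 : pairIdeal p f (e + v) (N * p ^ v) = frobeniusPower p (pairIdeal p f e N) v := by
    rw [← add_zero (N * p ^ v), h1]
    ext x
    simp [Submodule.mem_colon_singleton]
  have h3 := pairLength_ne_top (R := R) p f (e + v) (N * p ^ v)
  rw [pairLength, h2] at h3 ⊢
  exact length_quotient_frobeniusPower hF v h3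

/-- For `e = w + v` the exponent is `⌈b p^v - t⌉ = b p^v`, because `0 ≤ t < 1`; the lengths then
scale exactly by `p^{vd}`, so the sequence is constant from `w` on. -/
theorem tendsto_fSignatureSeq (hF : (frobenius R p).Finite) (f : R) {t : ℝ} {b w : ℕ} (ht1 : t < 1)
    (ht : t = (b : ℝ) / (p : ℝ) ^ w) :
    Tendsto (fSignatureSeq p f t) atTop
      (𝓝 (((pairLength p f w b).toNat : ℝ) / (p : ℝ) ^ (w * dimNat R))) := by
  have hp0 : (0 : ℝ) < p := by exact_mod_cast hp.out.pos
  refine tendsto_const_nhds.congr' (eventually_atTop.2 ⟨w, fun e he => ?_⟩)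
  obtain ⟨v, rfl⟩ := Nat.exists_eq_add_of_le he
  have hx : t * ((p : ℝ) ^ (w + v) - 1) = ((b * p ^ v : ℕ) : ℝ) - t := by
    rw [ht, pow_add]
    push_cast
    field_simp
  have ht0 : 0 ≤ t := by
    rw [ht]
    positivity
  have hceil : ⌈t * ((p : ℝ) ^ (w + v) - 1)⌉₊ = b * p ^ v := by
    rw [hx]
    apply le_antisymm
    · exact Nat.ceil_le.2 (by linarith)
    · refine Nat.le_of_lt_succ ?_
      have h := Nat.le_ceil (((b * p ^ v : ℕ) : ℝ) - t)
      have h' : ((b * p ^ v : ℕ) : ℝ) < ((⌈((b * p ^ v : ℕ) : ℝ) - t⌉₊ + 1 : ℕ) : ℝ) := by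
        push_cast at h ⊢
        linarith
      exact Nat.cast_lt.1 h'
  rw [fSignatureSeq, hceil, pairLength_mul_pow hF, ENat.toNat_mul, ENat.toNat_natCast, add_mul,
    pow_add]
  push_cast
  field_simp

end Signature

/-! ### Assembling the limsup -/

section Main

theorem ofReal_zpow {x : ℝ} (hx : 0 < x) (n : ℤ) :
    ENNReal.ofReal (x ^ n) = ENNReal.ofReal x ^ n := by
  cases n with
  | ofNat n => simp [ENNReal.ofReal_pow hx.le]
  | negSucc n =>
    rw [zpow_negSucc, zpow_negSucc, ENNReal.ofReal_inv_of_pos (by positivity),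
      ENNReal.ofReal_pow hx.le]

theorem ceil_mul_pow_sub_one {p : ℕ} (hp1 : 1 < p) {c : ℝ} {a s : ℕ} (hs : 0 < s)
    (ha : c = (a : ℝ) / ((p : ℝ) ^ s - 1)) (k : ℕ) :
    ⌈c * ((p : ℝ) ^ (k * s) - 1)⌉₊ = a * geomSum (p ^ s) k := by
  have hs1 : 0 < (p : ℝ) ^ s - 1 := by
    have : (1 : ℝ) < (p : ℝ) ^ s := one_lt_pow₀ (by exact_mod_cast hp1) hs.ne'
    linarith
  have h := geomSum_mul (p ^ s) k
  push_cast at h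
  have h1 : c * ((p : ℝ) ^ (k * s) - 1) = ((a * geomSum (p ^ s) k : ℕ) : ℝ) := by
    rw [mul_comm k s, pow_mul, ← h, ha]
    push_cast
    field_simp
  rw [h1, Nat.ceil_natCast]

theorem approx_eq {p : ℕ} (hp1 : 1 < p) {c : ℝ} {a s : ℕ} (hs : 0 < s)
    (ha : c = (a : ℝ) / ((p : ℝ) ^ s - 1)) (e : ℕ) :
    approx p a s e = ((a * geomSum (p ^ s) e : ℕ) : ℝ) / (p : ℝ) ^ (e * s) ∧
      approx p a s e - c = -c / (p : ℝ) ^ (e * s) := by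
  have hp0 : (0 : ℝ) < p := by exact_mod_cast (zero_lt_one.trans hp1)
  have hs1 : 0 < (p : ℝ) ^ s - 1 := by
    have : (1 : ℝ) < (p : ℝ) ^ s := one_lt_pow₀ (by exact_mod_cast hp1) hs.ne'
    linarith
  have h1 : approx p a s e = ((a * geomSum (p ^ s) e : ℕ) : ℝ) / (p : ℝ) ^ (e * s) := by
    rw [approx, geomSum]
    push_cast
    congr 2
    exact Finset.sum_congr rfl fun i _ => by rw [← pow_mul, mul_comm]
  refine ⟨h1, ?_⟩
  have h := geomSum_mul (p ^ s) e
  push_cast at h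
  have h2 : (a : ℝ) = c * ((p : ℝ) ^ s - 1) := by
    rw [ha]
    field_simp
  rw [h1]
  push_cast
  rw [h2, mul_assoc, mul_comm _ (geomSum (p ^ s) e : ℝ), h, mul_comm e s, pow_mul]
  have : 0 < ((p : ℝ) ^ s) ^ e := by positivity
  field_simp
  ring

variable {R : Type u} [CommRing R] [IsRegularLocalRing R] {p : ℕ} [hp : Fact p.Prime] [ExpChar R p]

/-- A nonzero length means `f^N ∉ 𝔪^{[p^e]}` for `N = ⌈c(p^e-1)⌉`. Then `N ≤ c(p^e-1)` by the
definition of the threshold, so the rounding is trivial and `c(p^e-1)` is an integer. -/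
theorem dvd_of_pairLength_ne_zero (hF : (frobenius R p).Finite) {f : R} {c : ℝ}
    (hc : fpt p f = (c : EReal)) {s : ℕ}
    (hs : ∀ e N : ℕ, (N : ℝ) = c * ((p : ℝ) ^ e - 1) → s ∣ e) {e : ℕ}
    (h : pairLength p f e ⌈c * ((p : ℝ) ^ e - 1)⌉₊ ≠ 0) : s ∣ e := by
  rcases Nat.eq_zero_or_pos e with rfl | he
  · exact dvd_zero s
  refine hs e ⌈c * ((p : ℝ) ^ e - 1)⌉₊ (le_antisymm (le_mul_of_fpt hF hc hp.out.one_lt he ?_)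
    (Nat.le_ceil _))
  intro hmem
  refine h ?_
  rw [pairLength, Module.length_eq_zero_iff, Ideal.Quotient.subsingleton_iff,
    Ideal.eq_top_iff_one, pairIdeal, Submodule.mem_colon_singleton, one_smul]
  exact hmem

theorem splittingLimsup_eq_of_tendsto (hF : (frobenius R p).Finite) {f : R} {c : ℝ}
    (hc : fpt p f = (c : EReal)) {a s : ℕ} (hs : 0 < s) (ha : c = (a : ℝ) / ((p : ℝ) ^ s - 1))
    (hdvd : ∀ e N : ℕ, (N : ℝ) = c * ((p : ℝ) ^ e - 1) → s ∣ e) {m : ℤ} {r : ℝ}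
    (h : Tendsto (fun k => ((Module.length R (R ⧸ splitIdeal p f s a k)).toNat : ℝ) /
        ((p : ℝ) ^ (k * s)) ^ m) atTop (𝓝 r)) :
    splittingLimsup p f c m = ENNReal.ofReal r := by
  have hp0 : (0 : ℝ) < p := by exact_mod_cast hp.out.pos
  refine limsup_eq_of_tendsto_mul hs (fun e he => ?_) ?_
  · have : pairLength p f e ⌈c * ((p : ℝ) ^ e - 1)⌉₊ = 0 := by
      by_contra hne
      exact he (dvd_of_pairLength_ne_zero hF hc hdvd hne)
    rw [this]
    simp
  · refine (ENNReal.tendsto_ofReal h).congr fun k => ?_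
    rw [ceil_mul_pow_sub_one hp.out.one_lt hs ha]
    change _ = _ * ((Module.length R (R ⧸ splitIdeal p f s a k) : ℕ∞) : ℝ≥0∞)
    obtain ⟨l, hl⟩ := ENat.ne_top_iff_exists.1
      (length_splitIdeal_ne_top (p := p) (f := f) (s := s) (a := a) k)
    rw [← hl, ENat.toNat_natCast, div_eq_mul_inv, mul_comm, ENNReal.ofReal_mul (by positivity),
      ENNReal.ofReal_natCast, ENat.toENNReal_coe]
    congr 1
    rw [← zpow_natCast, ← zpow_mul, ← zpow_neg, ofReal_zpow hp0, ENNReal.ofReal_natCast]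

end Main

end FPair

theorem mainTheorem1 {R : Type*} [CommRing R] [IsDomain R] [IsRegularLocalRing R]
    (p : ℕ) [Fact p.Prime] [CharP R p] (hF : (frobenius R p).Finite)
    (f : R) (hf : f ≠ 0)
    (c : ℚ) (hc : FPair.fpt p f = ((c : ℝ) : EReal)) (hden : ¬ p ∣ c.den) :
    (∃ a s : ℕ, 0 < s ∧ (c : ℝ) = (a : ℝ) / ((p : ℝ) ^ s - 1)) ∧
    IsGreatest {m : ℤ | FPair.splittingLimsup p f c m ≠ 0} (FPair.splittingDim p f c) ∧
    FPair.splittingRatio p f c ≠ ⊤ ∧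
    ∀ a s : ℕ, 0 < s → (c : ℝ) = (a : ℝ) / ((p : ℝ) ^ s - 1) →
      Tendsto (fun e : ℕ => FPair.approx p a s e) atTop (𝓝 (c : ℝ)) ∧
      (∀ e : ℕ, Tendsto (FPair.fSignatureSeq p f (FPair.approx p a s e)) atTop
        (𝓝 (FPair.fSignature p f (FPair.approx p a s e)))) ∧
      ∀ n : ℤ, n = (FPair.dimNat R : ℤ) - FPair.splittingDim p f c →
        limsup (fun e : ℕ =>
            ((FPair.fSignature p f (FPair.approx p a s e) /
              (FPair.approx p a s e - (c : ℝ)) ^ n : ℝ) : EReal)) atTop =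
          (((-(c : ℝ)) ^ (-n) * (FPair.splittingRatio p f c).toReal : ℝ) : EReal) := by
  have hp : p.Prime := Fact.out
  have hp1 : (1 : ℝ) < p := by exact_mod_cast hp.one_lt
  have hp0 : (0 : ℝ) < p := by positivity
  have hcpos := FPair.fpt_pos hF hf hc hp.one_lt
  -- Needed for `t_e < c ≤ 1`, which keeps the ceilings in the signature sequence exact.
  have hc1 : (c : ℝ) ≤ 1 := by
    have := FPair.fpt_le_one hF (FPair.mem_maximalIdeal_of_fpt hF hc hp.one_lt) hp.one_lt
    rw [hc] at this
    exact_mod_cast this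
  obtain ⟨s₀, a₀, hs₀, ha₀, hdvd⟩ :=
    FPair.exists_mul_pow_sub_one hp hden (by exact_mod_cast hcpos.le)
  have hfa₀ := FPair.pow_notMem_of_fpt hF hf hc hp.one_lt hs₀ ha₀
  obtain ⟨m, r, hr, hlim⟩ := FPair.exists_tendsto_length_splitIdeal hF hs₀ hfa₀
  have hm := FPair.splittingLimsup_eq_of_tendsto hF hc hs₀ ha₀ hdvd hlim
  have hzero : ∀ m' : ℤ, m < m' → FPair.splittingLimsup p f c m' = 0 := by
    intro m' hm'
    rw [← ENNReal.ofReal_zero]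
    refine FPair.splittingLimsup_eq_of_tendsto hF hc hs₀ ha₀ hdvd ?_
    obtain ⟨i, hi⟩ := Int.exists_add_of_le hm'.le
    have hi0 : i ≠ 0 := by
      rintro rfl
      simp at hi
      omega
    have h1 : Tendsto (fun k : ℕ => ((((p : ℝ) ^ s₀) ^ i)⁻¹) ^ k) atTop (𝓝 0) :=
      tendsto_pow_atTop_nhds_zero_of_lt_one (by positivity)
        (inv_lt_one_of_one_lt₀ (one_lt_pow₀ (one_lt_pow₀ hp1 hs₀.ne') hi0))
    have h2 := hlim.mul h1
    rw [mul_zero] at h2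
    refine h2.congr fun k => ?_
    rw [hi, zpow_add₀ (by positivity), zpow_natCast, inv_pow, ← pow_mul, ← pow_mul, ← pow_mul,
      ← div_eq_mul_inv, div_div]
    congr 3
    ring
  have hgreat : IsGreatest {m : ℤ | FPair.splittingLimsup p f c m ≠ 0} m := by
    refine ⟨?_, fun m' hm' => ?_⟩
    · change FPair.splittingLimsup p f c m ≠ 0
      rw [hm]
      simpa using hr
    · by_contra! hlt
      exact hm' (hzero m' hlt)
  -- The supremum in `ℤ` carries meaning only because a greatest element has been exhibited.
  have hdim : FPair.splittingDim p f c = m := hgreat.csSup_eq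
  have hratio : FPair.splittingRatio p f c = ENNReal.ofReal r := by
    rw [FPair.splittingRatio, hdim, hm]
  refine ⟨⟨a₀, s₀, hs₀, ha₀⟩, hdim ▸ hgreat, by rw [hratio]; exact ENNReal.ofReal_ne_top,
    fun a s hs ha => ?_⟩
  have happ := FPair.approx_eq hp.one_lt hs ha
  have hsig : ∀ e, Tendsto (FPair.fSignatureSeq p f (FPair.approx p a s e)) atTop
      (𝓝 (((FPair.pairLength p f (e * s) (a * FPair.geomSum (p ^ s) e)).toNat : ℝ) /
        (p : ℝ) ^ (e * s * FPair.dimNat R))) := by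
    intro e
    refine FPair.tendsto_fSignatureSeq hF f ?_ (happ e).1
    have h1 := (happ e).2
    have h2 : -(c : ℝ) / (p : ℝ) ^ (e * s) < 0 := div_neg_of_neg_of_pos (by linarith) (by positivity)
    linarith
  have hsig' : ∀ e, FPair.fSignature p f (FPair.approx p a s e) = _ := fun e => (hsig e).limUnder_eq
  refine ⟨?_, fun e => ?_, fun n hn => ?_⟩
  · have h1 : Tendsto (fun e : ℕ => (c : ℝ) - c * (((p : ℝ) ^ s)⁻¹) ^ e) atTop (𝓝 (c - c * 0)) :=
      ((tendsto_pow_atTop_nhds_zero_of_lt_one (by positivity)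
        (inv_lt_one_of_one_lt₀ (one_lt_pow₀ hp1 hs.ne'))).const_mul _).const_sub _
    rw [mul_zero, sub_zero] at h1
    refine h1.congr fun e => ?_
    rw [eq_add_of_sub_eq (happ e).2, inv_pow, ← pow_mul, mul_comm s e]
    ring
  · rw [hsig' e]
    exact hsig e
  · rw [hdim] at hn
    rw [hratio, ENNReal.toReal_ofReal hr.le]
    -- The ideals for `(a, s)` are the subsequence of those for `(a₀, s₀)` at the indices `e * l`,
    -- so the limit already found applies.
    obtain ⟨l, rfl⟩ : s₀ ∣ s := by
      refine hdvd s a ?_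
      have : (1 : ℝ) < (p : ℝ) ^ s := one_lt_pow₀ hp1 hs.ne'
      rw [ha, div_mul_cancel₀ _ (by linarith)]
    have hl : 0 < l := Nat.pos_of_mul_pos_left hs
    have htend : Tendsto (fun e : ℕ => e * l) atTop atTop := tendsto_id.atTop_mul_const' hl
    have h1 := (hlim.comp htend).const_mul ((-(c : ℝ)) ^ (-n))
    refine Tendsto.limsup_eq ((continuous_coe_real_ereal.tendsto _).comp (h1.congr fun e => ?_))
    have hidx : e * l * s₀ = e * (s₀ * l) := by ring
    -- Both sides are `⌈c(p^{es}-1)⌉`, computed from the two representations of `c`.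
    have hN : a₀ * FPair.geomSum (p ^ s₀) (e * l) = a * FPair.geomSum (p ^ (s₀ * l)) e := by
      rw [← FPair.ceil_mul_pow_sub_one hp.one_lt hs₀ ha₀, hidx,
        FPair.ceil_mul_pow_sub_one hp.one_lt hs ha]
    have hlen : Module.length R (R ⧸ FPair.splitIdeal p f s₀ a₀ (e * l)) =
        FPair.pairLength p f (e * (s₀ * l)) (a * FPair.geomSum (p ^ (s₀ * l)) e) := by
      rw [FPair.pairLength, ← hN, ← hidx]
      rfl
    rw [hsig' e, (happ e).2, Function.comp_apply, hlen, hidx, div_zpow, pow_mul _ _ (FPair.dimNat R),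
      ← zpow_natCast _ (FPair.dimNat R)]
    have hQ : (0 : ℝ) < (p : ℝ) ^ (e * (s₀ * l)) := by positivity
    have hd : (FPair.dimNat R : ℤ) = n + m := by rw [hn]; ring
    have hcn : (-(c : ℝ)) ^ n ≠ 0 := zpow_ne_zero _ (by linarith)
    have hQn : ((p : ℝ) ^ (e * (s₀ * l))) ^ n ≠ 0 := zpow_ne_zero _ hQ.ne'
    have hQm : ((p : ℝ) ^ (e * (s₀ * l))) ^ m ≠ 0 := zpow_ne_zero _ hQ.ne'
    rw [hd, zpow_add₀ hQ.ne', zpow_neg]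
    generalize ((p : ℝ) ^ (e * (s₀ * l))) ^ n = A at *
    generalize ((p : ℝ) ^ (e * (s₀ * l))) ^ m = B at *
    generalize (-(c : ℝ)) ^ n = E at *
    field_simp
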